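/- Let $\mathcal G$ be the set of isomorphism classes of finite simple graphs (isolated vertices allowed, empty graph $\mathbf e$ included), and let $\tilde{\mathcal G}\subset\mathcal G$ be the classes of graphs without isolated vertices (including $\mathbf e$). A connected graph is by convention non-empty. For $X=\mathcal G$ or $\tilde{\mathcal G}$ let $\mathbb R\langle X\rangle$ be the real vector space with basis $X$, and $\langle\cdot,\cdot\rangle$ the pairing for which $X$ (respectively $\{\sigma\otimes\tau\}$) is orthonormal. For a graph $\tau=(V,E)$ let $\tau_U$ be the subgraph induced on $U\subseteq V$, and for $A\subseteq E$ let $\tau|_A=(\bigcup A,A)$. Let $\sqcup$ be the bilinear extension of the disjoint union and define coproducts as follows. * $\Delta_\sqcup(\tau)=\sum_{\tau_1\sqcup\tau_2=\tau}\tau_1\otimes\tau_2$, the sum over pairs $(\tau_1,\tau_2)\in X\times X$; * $\Delta_{\mathrm{DP}}(\tau)=\tau\otimes\mathbf e+\mathbf e\otimes\tau$ for connected $\tau$, extended as an algebra morphism for $\sqcup$; * on $\mathbb R\langle\mathcal G\rangle$: $\Delta_{\mathrm{is}}(\tau)=\sum_{U\subseteq V}\tau_U\otimes\tau_{V\setminus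 U}$ and $\Delta_{\mathrm{qis}}(\tau)=\sum_{I\cup J=V}\tau_I\otimes\tau_J$; * on $\mathbb R\langle\tilde{\mathcal G}\rangle$: $\Delta_{\mathrm{sh}}(\tau)=\sum_{A\subseteq E}\tau|_A\otimes\tau|_{E\setminus A}$ and $\Delta_{\mathrm{qs}}(\tau)=\sum_{A\cup B=E}\tau|_A\otimes\tau|_B$. Each of the last five coproducts $\Delta_\bullet$ defines a dual product by the finite sum $\sigma\bullet\tau=\sum_{\gamma\in X}\langle\sigma\otimes\tau,\Delta_\bullet(\gamma)\rangle\,\gamma$: the divided powers product $\cdot_{\mathrm{DP}}$ (on $\mathbb R\langle\mathcal G\rangle$ and on $\mathbb R\langle\tilde{\mathcal G}\rangle$), the induced shuffle and the induced quasi-shuffle (on $\mathbb R\langle\mathcal G\rangle$, and by restriction on $\mathbb R\langle\tilde{\mathcal G}\rangle$), and the shuffle and the quasi-shuffle (on $\mathbb R\langle\tilde{\mathcal G}\rangle$). In all cases the unit is $\mathbf e$ and the counit is $\varepsilon(\tau)=\delta_{\tau,\mathbf e}$. **Proposition.** Let either $X=\mathcal G$ and let $\dagger$ be one of $\cdot_{\mathrm{DP}}$,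 induced shuffle, induced quasi-shuffle; or $X=\tilde{\mathcal G}$ and let $\dagger$ be one of $\cdot_{\mathrm{DP}}$, shuffle, quasi-shuffle, induced shuffle, induced quasi-shuffle. Then $(\mathbb R\langle X\rangle,\sqcup,\Delta_{\mathrm{DP}})$ and $(\mathbb R\langle X\rangle,\dagger,\Delta_\sqcup)$ are commutative Hopf algebras, and the inclusion of the connected graphs extends naturally to an isomorphism of Hopf algebras $$\Psi_\dagger:(\mathbb R\langle X\rangle,\sqcup,\Delta_{\mathrm{DP}})\longrightarrow(\mathbb R\langle X\rangle,\dagger,\Delta_\sqcup),\qquad \Psi_\dagger(\tau_1\sqcup\dots\sqcup\tau_n)=\tau_1\dagger\cdots\dagger\tau_n$$ for all $n\ge 0$ and all connected $\tau_1,\dots,\tau_n\in X$. In particular, the commutative algebra $(\mathbb R\langle X\rangle,\dagger)$ is freely generated by the connected graphs in $X$. -/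

import Mathlib

open scoped TensorProduct

noncomputable section

/-! ### Isomorphism classes of finite simple graphs -/

/-- Finite simple graphs on an initial segment of `ℕ`, up to isomorphism. -/
instance finGraphSetoid : Setoid (Σ n : ℕ, SimpleGraph (Fin n)) where
  r G H := Nonempty (G.2 ≃g H.2)
  iseqv := ⟨fun _ => ⟨SimpleGraph.Iso.refl⟩, fun ⟨e⟩ => ⟨e.symm⟩, fun ⟨e⟩ ⟨f⟩ => ⟨e.trans f⟩⟩

/-- The set of isomorphism classes of finite simple graphs (isolated vertices and the empty graph
are allowed). -/
def FinGraph : Type := Quotient finGraphSetoid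

namespace FinGraph

/-- The isomorphism class of a finite simple graph. -/
def of {V : Type} [Finite V] (G : SimpleGraph V) : FinGraph :=
  Quotient.mk finGraphSetoid ⟨Nat.card V, G.map (Finite.equivFin V).toEmbedding⟩

theorem of_fin {n : ℕ} (G : SimpleGraph (Fin n)) :
    of G = Quotient.mk finGraphSetoid ⟨n, G⟩ :=
  Quotient.sound ⟨(SimpleGraph.Iso.map (Finite.equivFin (Fin n)) G).symm⟩

theorem of_eq_of_iff {V W : Type} [Finite V] [Finite W] {G : SimpleGraph V} {H : SimpleGraph W} :
    of G = of H ↔ Nonempty (G ≃g H) := by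
  have hG := SimpleGraph.Iso.map (Finite.equivFin V) G
  have hH := SimpleGraph.Iso.map (Finite.equivFin W) H
  refine Quotient.eq.trans ⟨fun ⟨e⟩ => ⟨(hG.trans e).trans hH.symm⟩, fun ⟨e⟩ => ⟨(hG.symm.trans e).trans hH⟩⟩

theorem of_eq {V W : Type} [Finite V] [Finite W] {G : SimpleGraph V} {H : SimpleGraph W}
    (e : G ≃g H) : of G = of H := of_eq_of_iff.2 ⟨e⟩

@[elab_as_elim]
theorem ind {P : FinGraph → Prop} (h : ∀ (n : ℕ) (G : SimpleGraph (Fin n)), P (of G))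
    (τ : FinGraph) : P τ := by
  induction τ using Quotient.ind with
  | _ G => exact of_fin G.2 ▸ h G.1 G.2

/-- The number of vertices. -/
def card : FinGraph → ℕ :=
  Quotient.lift (fun G => G.1) fun _ _ ⟨e⟩ => Fin.equiv_iff_eq.1 ⟨e.toEquiv⟩

@[simp]
theorem card_of {V : Type} [Finite V] (G : SimpleGraph V) : (of G).card = Nat.card V := rfl

theorem finite_card_le (n : ℕ) : {τ : FinGraph | τ.card ≤ n}.Finite := by
  refine (Set.finite_range
    (fun G : (Σ i : Fin (n + 1), SimpleGraph (Fin i)) => of G.2)).subset ?_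
  intro τ
  induction τ using ind with
  | h m G =>
    intro h
    have h : Nat.card (Fin m) ≤ n := h
    rw [Nat.card_fin] at h
    exact ⟨⟨⟨m, by omega⟩, G⟩, rfl⟩

/-- A connected graph has at least one vertex, so the empty graph is not connected. -/
def Connected : FinGraph → Prop :=
  Quotient.lift (fun G => G.2.Connected) fun _ _ ⟨e⟩ => propext e.connected_iff

@[simp]
theorem connected_of {V : Type} [Finite V] (G : SimpleGraph V) :
    (of G).Connected ↔ G.Connected :=
  (SimpleGraph.Iso.map (Finite.equivFin V) G).symm.connected_iff

/-- Every vertex has a neighbour. The empty graph has no isolated vertices. -/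
def NoIsolated : FinGraph → Prop :=
  Quotient.lift (fun G => ∀ v, ∃ w, G.2.Adj v w) fun G H ⟨e⟩ => propext
    ⟨fun h v => (h (e.symm v)).imp' e fun w hw => by simpa using e.map_rel_iff.2 hw,
     fun h v => (h (e v)).imp' e.symm fun w hw => by simpa using e.symm.map_rel_iff.2 hw⟩

@[simp]
theorem noIsolated_of {V : Type} [Finite V] (G : SimpleGraph V) :
    (of G).NoIsolated ↔ ∀ v, ∃ w, G.Adj v w := by
  have e := SimpleGraph.Iso.map (Finite.equivFin V) G
  exact ⟨fun h v => (h (e v)).imp' e.symm fun w hw => by simpa using e.symm.map_rel_iff.2 hw,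
    fun h v => (h (e.symm v)).imp' e fun w hw => by simpa using e.map_rel_iff.2 hw⟩

/-- The disjoint union of two graphs. -/
def disjUnion : FinGraph → FinGraph → FinGraph :=
  Quotient.map₂ (fun G H => ⟨Nat.card (Fin G.1 ⊕ Fin H.1),
      (G.2 ⊕g H.2).map (Finite.equivFin _).toEmbedding⟩)
    fun _ _ ⟨e⟩ _ _ ⟨f⟩ => Quotient.exact (of_eq (SimpleGraph.Iso.sumCongr e f))

theorem disjUnion_of {V W : Type} [Finite V] [Finite W] (G : SimpleGraph V) (H : SimpleGraph W) :
    disjUnion (of G) (of H) = of (G ⊕g H) :=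
  of_eq (SimpleGraph.Iso.sumCongr (SimpleGraph.Iso.map (Finite.equivFin V) G).symm
    (SimpleGraph.Iso.map (Finite.equivFin W) H).symm)

/-- Disjoint union of graphs is written additively; the empty graph is `0`. -/
instance : AddCommMonoid FinGraph where
  add := disjUnion
  zero := of (⊥ : SimpleGraph Empty)
  add_assoc a b c := by
    induction a using ind with | h _ G => induction b using ind with | h _ H =>
    induction c using ind with | h _ K =>
    change disjUnion (disjUnion _ _) _ = disjUnion _ (disjUnion _ _)
    simp only [disjUnion_of]
    exact of_eq SimpleGraph.Iso.sumAssoc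
  zero_add a := by
    induction a using ind with | h _ G =>
    change disjUnion (of _) _ = _
    rw [disjUnion_of]
    exact of_eq ⟨Equiv.emptySum _ _, by rintro (x | x) (y | y) <;> first | exact x.elim | exact y.elim | simp⟩
  add_zero a := by
    induction a using ind with | h _ G =>
    change disjUnion _ (of _) = _
    rw [disjUnion_of]
    exact of_eq ⟨Equiv.sumEmpty _ _, by rintro (x | x) (y | y) <;> first | exact x.elim | exact y.elim | simp⟩
  add_comm a b := by
    induction a using ind with | h _ G => induction b using ind with | h _ H =>
    change disjUnion _ _ = disjUnion _ _
    simp only [disjUnion_of]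
    exact of_eq SimpleGraph.Iso.sumComm
  nsmul n x := @nsmulRec _ ⟨of (⊥ : SimpleGraph Empty)⟩ ⟨disjUnion⟩ n x

theorem zero_def : (0 : FinGraph) = of (⊥ : SimpleGraph Empty) := rfl

theorem of_add_of {V W : Type} [Finite V] [Finite W] (G : SimpleGraph V) (H : SimpleGraph W) :
    of G + of H = of (G ⊕g H) := disjUnion_of G H

@[simp]
theorem card_zero : card 0 = 0 := by simp [zero_def]

@[simp]
theorem card_add (a b : FinGraph) : (a + b).card = a.card + b.card := by
  induction a using ind with | h _ G => induction b using ind with | h _ H =>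
  simp [of_add_of]

theorem finite_antidiagonal (τ : FinGraph) : {p : FinGraph × FinGraph | p.1 + p.2 = τ}.Finite := by
  refine ((finite_card_le τ.card).prod (finite_card_le τ.card)).subset ?_
  rintro ⟨a, b⟩ rfl
  simp [Set.mem_prod]

/-- The connected components of a graph, as a multiset of isomorphism classes of graphs. -/
def componentsOf {V : Type} [Finite V] (G : SimpleGraph V) : Multiset FinGraph :=
  letI := Fintype.ofFinite G.ConnectedComponent
  (Finset.univ : Finset G.ConnectedComponent).val.map fun c => of c.toSimpleGraph

theorem componentsOf_congr {V W : Type} [Finite V] [Finite W] {G : SimpleGraph V}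
    {H : SimpleGraph W} (e : G ≃g H) : componentsOf G = componentsOf H := by
  let := Fintype.ofFinite G.ConnectedComponent
  let := Fintype.ofFinite H.ConnectedComponent
  refine Multiset.map_eq_map_of_bij_of_nodup _ _ Finset.univ.nodup Finset.univ.nodup
    (fun c _ => e.connectedComponentEquiv c) (by simp)
    (fun c _ d _ h => e.connectedComponentEquiv.injective h)
    (fun c _ => ⟨e.connectedComponentEquiv.symm c, by simp⟩) fun c _ => of_eq ?_
  exact ⟨SimpleGraph.ConnectedComponent.isoEquivSupp e c, fun {a b} => e.map_rel_iff⟩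

/-- The connected components of an isomorphism class of graphs. -/
def components : FinGraph → Multiset FinGraph :=
  Quotient.lift (fun G => componentsOf G.2) fun _ _ ⟨e⟩ => componentsOf_congr e

@[simp]
theorem components_of {V : Type} [Finite V] (G : SimpleGraph V) :
    (of G).components = componentsOf G :=
  componentsOf_congr (SimpleGraph.Iso.map (Finite.equivFin V) G).symm

theorem connected_of_mem_components {τ c : FinGraph} (h : c ∈ τ.components) : c.Connected := by
  induction τ using ind with | h n G =>
  rw [components_of, componentsOf, Multiset.mem_map] at h
  obtain ⟨c, -, rfl⟩ := h
  exact (connected_of _).2 c.connected_toSimpleGraph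

theorem noIsolated_of_mem_components {τ c : FinGraph} (hτ : τ.NoIsolated)
    (h : c ∈ τ.components) : c.NoIsolated := by
  induction τ using ind with | h n G =>
  rw [components_of, componentsOf, Multiset.mem_map] at h
  rw [noIsolated_of] at hτ
  obtain ⟨c, -, rfl⟩ := h
  rw [noIsolated_of]
  rintro ⟨v, hv⟩
  obtain ⟨w, hw⟩ := hτ v
  exact ⟨⟨w, c.mem_supp_of_adj_mem_supp hv hw⟩, hw⟩

theorem card_sum_components (τ : FinGraph) : τ.components.sum.card = τ.card := by
  induction τ using ind with | h n G =>
  let := Fintype.ofFinite G.ConnectedComponent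
  have key : ∀ s : Multiset FinGraph, s.sum.card = (s.map card).sum := by
    intro s
    induction s using Multiset.induction with
    | empty => simp
    | cons a s ih => simp [ih]
  rw [key, components_of, componentsOf, Multiset.map_map]
  simp only [Function.comp_def, card_of]
  change ∑ c : G.ConnectedComponent, Nat.card c.supp = Nat.card (Fin n)
  rw [← Nat.card_sigma]
  exact Nat.card_congr (Equiv.sigmaFiberEquiv G.connectedComponentMk)

theorem components_connected {τ : FinGraph} (h : τ.Connected) : τ.components = {τ} := by
  induction τ using ind with | h n G =>
  rw [connected_of] at h
  let := Fintype.ofFinite G.ConnectedComponent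
  have := h.nonempty
  have hs : Subsingleton G.ConnectedComponent := h.preconnected.subsingleton_connectedComponent
  have c : G.ConnectedComponent := G.connectedComponentMk (Classical.arbitrary _)
  have hu : (Finset.univ : Finset G.ConnectedComponent) = {c} := by
    ext d; simp [Subsingleton.elim d c]
  rw [components_of, componentsOf, hu, Finset.singleton_val, Multiset.map_singleton]
  congr 1
  refine of_eq ⟨Equiv.subtypeUnivEquiv fun v => Subsingleton.elim _ _, ?_⟩
  exact Iff.rfl

theorem componentsOf_sum {V W : Type} [Finite V] [Finite W] (G : SimpleGraph V)
    (H : SimpleGraph W) : componentsOf (G ⊕g H) = componentsOf G + componentsOf H := by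
  let := Fintype.ofFinite G.ConnectedComponent
  let := Fintype.ofFinite H.ConnectedComponent
  let := Fintype.ofFinite (G ⊕g H).ConnectedComponent
  let il : G →g G ⊕g H := SimpleGraph.Embedding.sumInl.toHom
  let ir : H →g G ⊕g H := SimpleGraph.Embedding.sumInr.toHom
  have hreach : ∀ x y, (G ⊕g H).Reachable x y →
      (∀ v w, x = .inl v → y = .inl w → G.Reachable v w) ∧
      (∀ v w, x = .inr v → y = .inr w → H.Reachable v w) ∧
      (∀ v w, x = .inl v → y ≠ .inr w) ∧ (∀ v w, x = .inr v → y ≠ .inl w) := by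
    rintro x y ⟨p⟩
    induction p with
    | nil =>
      refine ⟨?_, ?_, ?_, ?_⟩ <;> rintro v w rfl h <;> first | cases h; exact .refl _ | cases h
    | @cons x y z hxy p ih =>
      obtain ⟨h1, h2, h3, h4⟩ := ih
      refine ⟨?_, ?_, ?_, ?_⟩ <;> rintro v w rfl h <;> subst h <;> rcases y with y | y
      · exact (SimpleGraph.Adj.reachable (by simpa using hxy)).trans (h1 y w rfl rfl)
      · simp at hxy
      · simp at hxy
      · exact (SimpleGraph.Adj.reachable (by simpa using hxy)).trans (h2 y w rfl rfl)
      · exact h3 y w rfl rfl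
      · simp at hxy
      · simp at hxy
      · exact h4 y w rfl rfl
  let f : G.ConnectedComponent ⊕ H.ConnectedComponent → (G ⊕g H).ConnectedComponent :=
    Sum.elim (fun c => c.map il) (fun c => c.map ir)
  have hf : Function.Bijective f := by
    constructor
    · rintro (c | c) (d | d) h <;> induction c using SimpleGraph.ConnectedComponent.ind <;>
        induction d using SimpleGraph.ConnectedComponent.ind
      all_goals
        have h := hreach _ _ (SimpleGraph.ConnectedComponent.exact h)
      · exact congrArg Sum.inl (SimpleGraph.ConnectedComponent.sound (h.1 _ _ rfl rfl))
      · exact absurd rfl (h.2.2.1 _ _ rfl)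
      · exact absurd rfl (h.2.2.2 _ _ rfl)
      · exact congrArg Sum.inr (SimpleGraph.ConnectedComponent.sound (h.2.1 _ _ rfl rfl))
    · intro c
      induction c using SimpleGraph.ConnectedComponent.ind with | h x =>
      rcases x with v | v
      · exact ⟨.inl (G.connectedComponentMk v), rfl⟩
      · exact ⟨.inr (H.connectedComponentMk v), rfl⟩
  have h1 : componentsOf (G ⊕g H) =
      (Finset.univ : Finset (G.ConnectedComponent ⊕ H.ConnectedComponent)).val.map
        fun c => of (f c).toSimpleGraph := by
    symm
    exact Multiset.map_eq_map_of_bij_of_nodup _ _ Finset.univ.nodup Finset.univ.nodup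
      (fun c _ => f c) (by simp) (fun c _ d _ h => hf.1 h)
      (fun c _ => by simpa using hf.2 c) fun c _ => rfl
  rw [h1, ← Finset.univ_disjSum_univ, Finset.val_disjSum, Multiset.disjSum, Multiset.map_add,
    Multiset.map_map, Multiset.map_map]
  congr 1 <;> refine Multiset.map_congr rfl fun c _ => ?_
  · refine of_eq (SimpleGraph.Iso.symm ⟨Equiv.ofBijective
      (fun v : c => ⟨Sum.inl v.1, ?_⟩ : c → (c.map il)) ⟨fun a b h => ?_, ?_⟩, ?_⟩)
    · exact (congrArg (SimpleGraph.ConnectedComponent.map il) v.2 :)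
    · exact Subtype.ext (Sum.inl_injective (congrArg Subtype.val h))
    · induction c using SimpleGraph.ConnectedComponent.ind with | h u =>
      rintro ⟨x, hx⟩
      have h := hreach _ _ (SimpleGraph.ConnectedComponent.exact hx).symm
      rcases x with x | x
      · exact ⟨⟨x, SimpleGraph.ConnectedComponent.sound (h.1 _ _ rfl rfl).symm⟩, rfl⟩
      · exact absurd rfl (h.2.2.1 _ _ rfl)
    · intro a b
      change (G ⊕g H).Adj (.inl a.1) (.inl b.1) ↔ G.Adj a.1 b.1
      simp
  · refine of_eq (SimpleGraph.Iso.symm ⟨Equiv.ofBijective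
      (fun v : c => ⟨Sum.inr v.1, ?_⟩ : c → (c.map ir)) ⟨fun a b h => ?_, ?_⟩, ?_⟩)
    · exact (congrArg (SimpleGraph.ConnectedComponent.map ir) v.2 :)
    · exact Subtype.ext (Sum.inr_injective (congrArg Subtype.val h))
    · induction c using SimpleGraph.ConnectedComponent.ind with | h u =>
      rintro ⟨x, hx⟩
      have h := hreach _ _ (SimpleGraph.ConnectedComponent.exact hx).symm
      rcases x with x | x
      · exact absurd rfl (h.2.2.2 _ _ rfl)
      · exact ⟨⟨x, SimpleGraph.ConnectedComponent.sound (h.2.1 _ _ rfl rfl).symm⟩, rfl⟩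
    · intro a b
      change (G ⊕g H).Adj (.inr a.1) (.inr b.1) ↔ H.Adj a.1 b.1
      simp

@[simp]
theorem components_add (a b : FinGraph) : (a + b).components = a.components + b.components := by
  induction a using ind with | h _ G => induction b using ind with | h _ H =>
  simp [of_add_of, componentsOf_sum]

@[simp]
theorem components_zero : components 0 = 0 := by
  have h := components_add 0 0
  simpa using h

/-- The submonoid of graphs without isolated vertices. -/
def noIsolated : AddSubmonoid FinGraph where
  carrier := {τ | τ.NoIsolated}
  zero_mem' := by simp [zero_def]
  add_mem' {a b} ha hb := by
    induction a using ind with | h _ G => induction b using ind with | h _ H =>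
    rw [Set.mem_ofPred_eq, noIsolated_of] at ha hb
    rw [Set.mem_ofPred_eq, of_add_of, noIsolated_of]
    rintro (v | v)
    · exact (ha v).imp' Sum.inl fun w hw => by simpa using hw
    · exact (hb v).imp' Sum.inr fun w hw => by simpa using hw

end FinGraph

/-- The set of isomorphism classes of finite simple graphs without isolated vertices. -/
abbrev FinGraphNo : Type := FinGraph.noIsolated

instance : Finset.HasAntidiagonal FinGraph where
  antidiagonal τ := τ.finite_antidiagonal.toFinset
  mem_antidiagonal := by simp

theorem FinGraphNo.finite_antidiagonal (τ : FinGraphNo) :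
    {p : FinGraphNo × FinGraphNo | p.1 + p.2 = τ}.Finite := by
  refine ((τ : FinGraph).finite_antidiagonal.preimage
    (Subtype.val_injective.prodMap Subtype.val_injective).injOn).subset ?_
  rintro ⟨a, b⟩ rfl
  simp

instance : Finset.HasAntidiagonal FinGraphNo where
  antidiagonal τ := τ.finite_antidiagonal.toFinset
  mem_antidiagonal := by simp

/-- The connected components of a graph without isolated vertices. -/
def FinGraphNo.components (τ : FinGraphNo) : Multiset FinGraphNo :=
  (τ : FinGraph).components.pmap Subtype.mk
    fun _ h => show _ ∈ FinGraph.noIsolated from FinGraph.noIsolated_of_mem_components τ.2 h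

/-! ### Linear algebra on the free vector space on a set of graphs -/

section Linear

variable {X : Type}

/-- A graph as a basis vector. -/
abbrev gr (τ : X) : X →₀ ℝ := Finsupp.single τ 1

/-- Linear extension of a map given on basis vectors. -/
abbrev linExt {W : Type} [AddCommMonoid W] [Module ℝ W] (f : X → W) : (X →₀ ℝ) →ₗ[ℝ] W :=
  Finsupp.linearCombination ℝ f

/-- Bilinear extension of a product given on basis vectors. -/
def bilinExt (f : X → X → (X →₀ ℝ)) : (X →₀ ℝ) →ₗ[ℝ] (X →₀ ℝ) →ₗ[ℝ] (X →₀ ℝ) :=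
  linExt fun σ => linExt (f σ)

@[simp]
theorem bilinExt_gr (f : X → X → (X →₀ ℝ)) (σ τ : X) : bilinExt f (gr σ) (gr τ) = f σ τ := by
  simp [bilinExt]

/-- The pairing `⟨σ ⊗ τ, x⟩`: the coefficient of `σ ⊗ τ` in `x`. -/
def pairing (σ τ : X) (x : (X →₀ ℝ) ⊗[ℝ] (X →₀ ℝ)) : ℝ :=
  finsuppTensorFinsupp' ℝ X X x (σ, τ)

/-- A coproduct `D`, given on basis vectors, can be dualized if every `σ ⊗ τ` occurs in only
finitely many of the `D γ`. -/
abbrev Dualizable (D : X → (X →₀ ℝ) ⊗[ℝ] (X →₀ ℝ)) : Prop :=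
  ∀ σ τ, {γ | pairing σ τ (D γ) ≠ 0}.Finite

/-- The product dual to a coproduct: `σ * τ = ∑_γ ⟨σ ⊗ τ, D γ⟩ γ`. -/
def dualProduct (D : X → (X →₀ ℝ) ⊗[ℝ] (X →₀ ℝ)) (hD : Dualizable D) :
    (X →₀ ℝ) →ₗ[ℝ] (X →₀ ℝ) →ₗ[ℝ] (X →₀ ℝ) :=
  bilinExt fun σ τ => Finsupp.ofSupportFinite (fun γ => pairing σ τ (D γ)) (hD σ τ)

/-- Coproduct of shuffle type on a finite ground set `S` with restriction map `r`:
the sum of `r(A) ⊗ r(S ∖ A)` over all `A ⊆ S`. -/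
def coShuffleSum {S : Type} [Finite S] (r : Set S → X) : (X →₀ ℝ) ⊗[ℝ] (X →₀ ℝ) :=
  letI := Fintype.ofFinite (Set S)
  ∑ A : Set S, gr (r A) ⊗ₜ[ℝ] gr (r Aᶜ)

open scoped Classical in
/-- Coproduct of quasi-shuffle type on a finite ground set `S` with restriction map `r`:
the sum of `r(A) ⊗ r(B)` over all `A ⊆ S` and all `B` with `S ∖ A ⊆ B ⊆ S`. -/
def coQuasiShuffleSum {S : Type} [Finite S] (r : Set S → X) : (X →₀ ℝ) ⊗[ℝ] (X →₀ ℝ) :=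
  letI := Fintype.ofFinite (Set S)
  ∑ A : Set S, ∑ B : Set S with Aᶜ ⊆ B, gr (r A) ⊗ₜ[ℝ] gr (r B)

theorem coShuffleSum_congr {S T : Type} [Finite S] [Finite T] (e : S ≃ T) (r : Set S → X)
    (r' : Set T → X) (h : ∀ A, r A = r' (e '' A)) : coShuffleSum r = coShuffleSum r' := by
  let := Fintype.ofFinite (Set S)
  let := Fintype.ofFinite (Set T)
  refine Fintype.sum_equiv (Equiv.Set.congr e) _ _ fun A => ?_
  rw [h, h, Set.image_compl_eq e.bijective]; rfl

theorem coQuasiShuffleSum_congr {S T : Type} [Finite S] [Finite T] (e : S ≃ T) (r : Set S → X)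
    (r' : Set T → X) (h : ∀ A, r A = r' (e '' A)) :
    coQuasiShuffleSum r = coQuasiShuffleSum r' := by
  let := Fintype.ofFinite (Set S)
  let := Fintype.ofFinite (Set T)
  refine Fintype.sum_equiv (Equiv.Set.congr e) _ _ fun A => ?_
  refine Finset.sum_equiv (Equiv.Set.congr e) (fun B => ?_) fun B _ => by rw [h, h]; rfl
  simp only [Finset.mem_filter, Finset.mem_univ, true_and]
  change _ ↔ (e '' A)ᶜ ⊆ e '' B
  rw [← Set.image_compl_eq e.bijective, Set.image_subset_image_iff e.injective]

theorem dualProduct_gr_apply {D : X → (X →₀ ℝ) ⊗[ℝ] (X →₀ ℝ)} (hD : Dualizable D) (σ τ γ : X) :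
    dualProduct D hD (gr σ) (gr τ) γ = pairing σ τ (D γ) := by
  rw [dualProduct, bilinExt_gr]; rfl

theorem pairing_gr_tmul_gr [DecidableEq X] (σ τ a b : X) :
    pairing σ τ (gr a ⊗ₜ[ℝ] gr b) = if a = σ ∧ b = τ then 1 else 0 := by
  simp [pairing, Finsupp.single_apply]

theorem exists_of_pairing_coShuffleSum {S : Type} [Finite S] {r : Set S → X} {σ τ : X}
    (h : pairing σ τ (coShuffleSum r) ≠ 0) : ∃ A B, A ∪ B = Set.univ ∧ r A = σ ∧ r B = τ := by
  classical
  let := Fintype.ofFinite (Set S)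
  have hs : pairing σ τ (coShuffleSum r) = ∑ A : Set S, pairing σ τ (gr (r A) ⊗ₜ[ℝ] gr (r Aᶜ)) := by
    simp [pairing, coShuffleSum]
  rw [hs] at h
  obtain ⟨A, -, hA⟩ := Finset.exists_ne_zero_of_sum_ne_zero h
  rw [pairing_gr_tmul_gr] at hA
  have := (ite_ne_right_iff.1 hA).1
  exact ⟨A, Aᶜ, Set.union_compl_self A, this⟩

theorem exists_of_pairing_coQuasiShuffleSum {S : Type} [Finite S] {r : Set S → X} {σ τ : X}
    (h : pairing σ τ (coQuasiShuffleSum r) ≠ 0) :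
    ∃ A B, A ∪ B = Set.univ ∧ r A = σ ∧ r B = τ := by
  classical
  let := Fintype.ofFinite (Set S)
  have hs : pairing σ τ (coQuasiShuffleSum r) =
      ∑ A : Set S, ∑ B : Set S with Aᶜ ⊆ B, pairing σ τ (gr (r A) ⊗ₜ[ℝ] gr (r B)) := by
    simp [pairing, coQuasiShuffleSum]
  rw [hs] at h
  obtain ⟨A, -, hA⟩ := Finset.exists_ne_zero_of_sum_ne_zero h
  obtain ⟨B, hB, hA⟩ := Finset.exists_ne_zero_of_sum_ne_zero hA
  rw [pairing_gr_tmul_gr] at hA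
  have := (ite_ne_right_iff.1 hA).1
  refine ⟨A, B, ?_, this⟩
  rw [Set.eq_univ_iff_forall]
  intro v
  by_cases hv : v ∈ A
  · exact Or.inl hv
  · exact Or.inr ((Finset.mem_filter.1 hB).2 hv)

end Linear

/-! ### Products and coproducts on graphs -/

section Common

variable {X : Type} [AddCommMonoid X]

/-- The product `⊔`: bilinear extension of the disjoint union. -/
def disjProduct : (X →₀ ℝ) →ₗ[ℝ] (X →₀ ℝ) →ₗ[ℝ] (X →₀ ℝ) :=
  bilinExt fun σ τ => gr (σ + τ)

/-- The coproduct `Δ_⊔`: the sum of `τ₁ ⊗ τ₂` over all pairs of graphs with `τ₁ ⊔ τ₂ = τ`. -/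
def coDisj [Finset.HasAntidiagonal X] (τ : X) : (X →₀ ℝ) ⊗[ℝ] (X →₀ ℝ) :=
  ∑ p ∈ Finset.HasAntidiagonal.antidiagonal τ, gr p.1 ⊗ₜ[ℝ] gr p.2

/-- The counit: `ε(e) = 1` for the empty graph `e`, and `ε(τ) = 0` for all other graphs `τ`. -/
def counitMap : (X →₀ ℝ) →ₗ[ℝ] ℝ := Finsupp.lapply 0

/-- The product of `c ⊗ e + e ⊗ c` over all `c` in a multiset of graphs, formed in the tensor
square of the algebra of graphs with the product `⊔`, that is, of the monoid algebra of the additive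
monoid of graphs. -/
def coDPProd (s : Multiset X) : (X →₀ ℝ) ⊗[ℝ] (X →₀ ℝ) :=
  TensorProduct.map (AddMonoidAlgebra.coeffLinearEquiv ℝ).toLinearMap
    (AddMonoidAlgebra.coeffLinearEquiv ℝ).toLinearMap
    (s.map fun c => (AddMonoidAlgebra.single c (1 : ℝ)) ⊗ₜ[ℝ] (1 : AddMonoidAlgebra ℝ X) +
      (1 : AddMonoidAlgebra ℝ X) ⊗ₜ[ℝ] (AddMonoidAlgebra.single c (1 : ℝ))).prod

theorem coDPProd_zero : coDPProd (0 : Multiset X) = gr 0 ⊗ₜ[ℝ] gr 0 := by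
  simp [coDPProd, Algebra.TensorProduct.one_def, AddMonoidAlgebra.one_def]

theorem coDPProd_singleton (c : X) : coDPProd {c} = gr c ⊗ₜ[ℝ] gr 0 + gr 0 ⊗ₜ[ℝ] gr c := by
  simp [coDPProd, AddMonoidAlgebra.one_def]

theorem coDPProd_add (s t : Multiset X) :
    coDPProd (s + t) = TensorProduct.map₂ disjProduct disjProduct (coDPProd s) (coDPProd t) := by
  unfold coDPProd
  rw [Multiset.map_add, Multiset.prod_add]
  have gen : ∀ x y : AddMonoidAlgebra ℝ X ⊗[ℝ] AddMonoidAlgebra ℝ X,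
      TensorProduct.map (AddMonoidAlgebra.coeffLinearEquiv ℝ).toLinearMap
        (AddMonoidAlgebra.coeffLinearEquiv ℝ).toLinearMap (x * y) =
      TensorProduct.map₂ disjProduct disjProduct
        (TensorProduct.map (AddMonoidAlgebra.coeffLinearEquiv ℝ).toLinearMap
          (AddMonoidAlgebra.coeffLinearEquiv ℝ).toLinearMap x)
        (TensorProduct.map (AddMonoidAlgebra.coeffLinearEquiv ℝ).toLinearMap
          (AddMonoidAlgebra.coeffLinearEquiv ℝ).toLinearMap y) := by
    intro x y
    induction x using TensorProduct.induction_on with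
    | zero => simp
    | add x x' h h' => simp [add_mul, h, h']
    | tmul a b =>
      induction y using TensorProduct.induction_on with
      | zero => simp
      | add x x' h h' => simp [mul_add, h, h']
      | tmul c d =>
        have key : ∀ u v : AddMonoidAlgebra ℝ X,
            (u * v).coeff = disjProduct u.coeff v.coeff := by
          intro u v
          induction u using AddMonoidAlgebra.induction_linear with
          | zero => simp
          | add f g hf hg => simp [add_mul, hf, hg]
          | single i r =>
            induction v using AddMonoidAlgebra.induction_linear with
            | zero => simp
            | add f g hf hg => simp [mul_add, hf, hg]
            | single j t =>
              simp [AddMonoidAlgebra.single_mul_single, disjProduct, bilinExt]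
        simp [key]
  exact gen _ _

theorem coDPProd_eq (s : Multiset X) : coDPProd s =
    (s.antidiagonal.map fun p => gr p.1.sum ⊗ₜ[ℝ] gr p.2.sum).sum := by
  have h1 : ∀ t : Multiset X, (t.map fun c => (AddMonoidAlgebra.single c (1 : ℝ)) ⊗ₜ[ℝ]
      (1 : AddMonoidAlgebra ℝ X)).prod = AddMonoidAlgebra.single t.sum (1 : ℝ) ⊗ₜ[ℝ] 1 := by
    intro t
    induction t using Multiset.induction with
    | empty => simp [Algebra.TensorProduct.one_def, AddMonoidAlgebra.one_def]
    | cons a t ih => simp [ih, AddMonoidAlgebra.single_mul_single]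
  have h2 : ∀ t : Multiset X, (t.map fun c => (1 : AddMonoidAlgebra ℝ X) ⊗ₜ[ℝ]
      (AddMonoidAlgebra.single c (1 : ℝ))).prod = 1 ⊗ₜ[ℝ] AddMonoidAlgebra.single t.sum (1 : ℝ) := by
    intro t
    induction t using Multiset.induction with
    | empty => simp [Algebra.TensorProduct.one_def, AddMonoidAlgebra.one_def]
    | cons a t ih => simp [ih, AddMonoidAlgebra.single_mul_single]
  rw [coDPProd, Multiset.prod_map_add, ← Multiset.sum_hom, Multiset.map_map]
  refine congrArg _ (Multiset.map_congr rfl fun p _ => ?_)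
  simp [h1, h2]

theorem exists_of_pairing_coDPProd {s : Multiset X} {σ τ : X}
    (h : pairing σ τ (coDPProd s) ≠ 0) : σ + τ = s.sum := by
  classical
  have hs : pairing σ τ (coDPProd s) =
      (s.antidiagonal.map fun p => pairing σ τ (gr p.1.sum ⊗ₜ[ℝ] gr p.2.sum)).sum := by
    rw [coDPProd_eq]
    simp only [pairing]
    rw [← LinearEquiv.coe_toLinearMap, ← Multiset.sum_hom, ← Finsupp.lapply_apply (R := ℝ),
      ← Multiset.sum_hom, Multiset.map_map, Multiset.map_map]
    rfl
  by_contra hne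
  refine h (hs.trans (Multiset.sum_eq_zero fun x hx => ?_))
  obtain ⟨p, hp, rfl⟩ := Multiset.mem_map.1 hx
  rw [pairing_gr_tmul_gr, if_neg]
  rintro ⟨rfl, rfl⟩
  rw [← Multiset.sum_add, Multiset.mem_antidiagonal.1 hp] at hne
  exact hne rfl

end Common

namespace FinGraph

/-- The divided powers coproduct `Δ_DP`: `τ ↦ τ ⊗ e + e ⊗ τ` on connected graphs, extended
multiplicatively to disjoint unions. -/
def coDP (τ : FinGraph) : (FinGraph →₀ ℝ) ⊗[ℝ] (FinGraph →₀ ℝ) := coDPProd τ.components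

theorem coDP_connected {τ : FinGraph} (h : τ.Connected) :
    coDP τ = gr τ ⊗ₜ[ℝ] gr 0 + gr 0 ⊗ₜ[ℝ] gr τ := by
  rw [coDP, components_connected h, coDPProd_singleton]

theorem coDP_zero : coDP 0 = gr 0 ⊗ₜ[ℝ] gr 0 := by
  rw [coDP, components_zero, coDPProd_zero]

theorem coDP_add (σ τ : FinGraph) :
    coDP (σ + τ) = TensorProduct.map₂ disjProduct disjProduct (coDP σ) (coDP τ) := by
  rw [coDP, components_add, coDPProd_add, coDP, coDP]

theorem dualizable_coDP : Dualizable coDP := fun σ τ =>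
  (finite_card_le (σ.card + τ.card)).subset fun γ h => by
    have := exists_of_pairing_coDPProd h
    rw [Set.mem_ofPred_eq, ← card_sum_components γ, ← this, card_add]

/-- The vertex-induced co-shuffle: the sum of `G_U ⊗ G_{V ∖ U}` over all vertex sets `U`. -/
def coInducedShuffle : FinGraph → (FinGraph →₀ ℝ) ⊗[ℝ] (FinGraph →₀ ℝ) :=
  Quotient.lift (fun G => coShuffleSum fun U => of (G.2.induce U)) fun _ _ ⟨e⟩ =>
    coShuffleSum_congr e.toEquiv _ _ fun _ => of_eq (e.induce e.injective.injOn.bijOn_image)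

/-- The vertex-induced co-quasi-shuffle: the sum of `G_I ⊗ G_J` over all vertex sets `I` and `J`
with `V ∖ I ⊆ J`. -/
def coInducedQuasiShuffle : FinGraph → (FinGraph →₀ ℝ) ⊗[ℝ] (FinGraph →₀ ℝ) :=
  Quotient.lift (fun G => coQuasiShuffleSum fun U => of (G.2.induce U)) fun _ _ ⟨e⟩ =>
    coQuasiShuffleSum_congr e.toEquiv _ _ fun _ => of_eq (e.induce e.injective.injOn.bijOn_image)

theorem coInducedShuffle_of {V : Type} [Finite V] (G : SimpleGraph V) :
    coInducedShuffle (of G) = coShuffleSum fun U => of (G.induce U) :=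
  let e := SimpleGraph.Iso.map (Finite.equivFin V) G
  (coShuffleSum_congr e.toEquiv _ _ fun _ => of_eq (e.induce e.injective.injOn.bijOn_image)).symm

theorem coInducedQuasiShuffle_of {V : Type} [Finite V] (G : SimpleGraph V) :
    coInducedQuasiShuffle (of G) = coQuasiShuffleSum fun U => of (G.induce U) :=
  let e := SimpleGraph.Iso.map (Finite.equivFin V) G
  (coQuasiShuffleSum_congr e.toEquiv _ _ fun _ => of_eq (e.induce e.injective.injOn.bijOn_image)).symm

theorem card_le_of_induce {V : Type} [Finite V] {G : SimpleGraph V} {A B : Set V}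
    (h : A ∪ B = Set.univ) : (of G).card ≤ (of (G.induce A)).card + (of (G.induce B)).card := by
  simp only [card_of, Nat.card_coe_set_eq]
  rw [← Set.ncard_univ, ← h]
  exact Set.ncard_union_le A B

theorem dualizable_coInducedShuffle : Dualizable coInducedShuffle := fun σ τ =>
  (finite_card_le (σ.card + τ.card)).subset fun γ h => by
    induction γ using ind with | h n G =>
    rw [Set.mem_ofPred_eq, coInducedShuffle_of] at h
    obtain ⟨A, B, hAB, rfl, rfl⟩ := exists_of_pairing_coShuffleSum h
    exact card_le_of_induce hAB

theorem dualizable_coInducedQuasiShuffle : Dualizable coInducedQuasiShuffle := fun σ τ =>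
  (finite_card_le (σ.card + τ.card)).subset fun γ h => by
    induction γ using ind with | h n G =>
    rw [Set.mem_ofPred_eq, coInducedQuasiShuffle_of] at h
    obtain ⟨A, B, hAB, rfl, rfl⟩ := exists_of_pairing_coQuasiShuffleSum h
    exact card_le_of_induce hAB

/-- The restricted graph `G|_A = (⋃ A, A)` for a set `A` of edges of `G`. -/
def edgeRestrict {V : Type} (G : SimpleGraph V) (A : Set G.edgeSet) :
    SimpleGraph {v : V | ∃ e ∈ A, v ∈ (e : Sym2 V)} :=
  (SimpleGraph.fromEdgeSet (Subtype.val '' A)).induce _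

theorem edgeRestrict_adj {V : Type} {G : SimpleGraph V} {A : Set G.edgeSet}
    {u v : {v : V | ∃ e ∈ A, v ∈ (e : Sym2 V)}} :
    (edgeRestrict G A).Adj u v ↔ ∃ e ∈ A, (e : Sym2 V) = s(u.1, v.1) := by
  simp only [edgeRestrict, SimpleGraph.comap_adj, SimpleGraph.fromEdgeSet_adj]
  constructor
  · rintro ⟨⟨e, he, h⟩, -⟩
    exact ⟨e, he, h⟩
  · rintro ⟨e, he, h⟩
    refine ⟨⟨e, he, h⟩, ?_⟩
    have := e.2
    rw [h] at this
    exact (SimpleGraph.mem_edgeSet G |>.1 this).ne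

theorem noIsolated_edgeRestrict {V : Type} [Finite V] (G : SimpleGraph V) (A : Set G.edgeSet) :
    (of (edgeRestrict G A)).NoIsolated := by
  rw [noIsolated_of]
  rintro ⟨v, e, he, hv⟩
  obtain ⟨w, hw⟩ := Sym2.mem_iff_exists.1 hv
  exact ⟨⟨w, e, he, hw ▸ Sym2.mem_mk_right v w⟩, edgeRestrict_adj.2 ⟨e, he, hw⟩⟩

/-- The restricted graph as a graph without isolated vertices. -/
def ofRestrict {V : Type} [Finite V] (G : SimpleGraph V) (A : Set G.edgeSet) : FinGraphNo :=
  ⟨of (edgeRestrict G A), noIsolated_edgeRestrict G A⟩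

theorem ofRestrict_congr {V W : Type} [Finite V] [Finite W] {G : SimpleGraph V}
    {H : SimpleGraph W} (e : G ≃g H) (A : Set G.edgeSet) :
    ofRestrict G A = ofRestrict H (e.mapEdgeSet '' A) := by
  refine Subtype.ext (of_eq ⟨e.toEquiv.subtypeEquiv fun v => ?_, fun {a b} => ?_⟩)
  · simp only [Set.mem_ofPred_eq, Set.exists_mem_image]
    refine exists_congr fun x => and_congr_right fun _ => ?_
    change _ ↔ e v ∈ Sym2.map e x.1
    rw [Sym2.mem_map]
    exact ⟨fun h => ⟨v, h, rfl⟩, fun ⟨w, hw, h⟩ => e.injective h ▸ hw⟩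
  · rw [edgeRestrict_adj, edgeRestrict_adj, Set.exists_mem_image]
    refine exists_congr fun x => and_congr_right fun _ => ?_
    change Sym2.map e x.1 = Sym2.map e s(a.1, b.1) ↔ _
    exact (Sym2.map.injective e.injective).eq_iff

/-- The edge-restricted co-shuffle: the sum of `G|_A ⊗ G|_{E ∖ A}` over all edge sets `A`. -/
def coEdgeShuffle : FinGraph → (FinGraphNo →₀ ℝ) ⊗[ℝ] (FinGraphNo →₀ ℝ) :=
  Quotient.lift (fun G => coShuffleSum fun A => ofRestrict G.2 A) fun _ _ ⟨e⟩ =>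
    coShuffleSum_congr e.mapEdgeSet _ _ (ofRestrict_congr e)

/-- The edge-restricted co-quasi-shuffle: the sum of `G|_A ⊗ G|_B` over all edge sets `A` and `B`
with `E ∖ A ⊆ B`. -/
def coEdgeQuasiShuffle : FinGraph → (FinGraphNo →₀ ℝ) ⊗[ℝ] (FinGraphNo →₀ ℝ) :=
  Quotient.lift (fun G => coQuasiShuffleSum fun A => ofRestrict G.2 A) fun _ _ ⟨e⟩ =>
    coQuasiShuffleSum_congr e.mapEdgeSet _ _ (ofRestrict_congr e)

theorem coEdgeShuffle_of {V : Type} [Finite V] (G : SimpleGraph V) :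
    coEdgeShuffle (of G) = coShuffleSum fun A => ofRestrict G A := by
  exact (coShuffleSum_congr (SimpleGraph.Iso.map (Finite.equivFin V) G).mapEdgeSet _ _
    (ofRestrict_congr _)).symm

theorem coEdgeQuasiShuffle_of {V : Type} [Finite V] (G : SimpleGraph V) :
    coEdgeQuasiShuffle (of G) = coQuasiShuffleSum fun A => ofRestrict G A := by
  exact (coQuasiShuffleSum_congr (SimpleGraph.Iso.map (Finite.equivFin V) G).mapEdgeSet _ _
    (ofRestrict_congr _)).symm

theorem card_le_of_restrict {V : Type} [Finite V] {G : SimpleGraph V} {A B : Set G.edgeSet}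
    (hG : ∀ v, ∃ w, G.Adj v w) (h : A ∪ B = Set.univ) :
    (of G).card ≤ (ofRestrict G A : FinGraph).card + (ofRestrict G B : FinGraph).card := by
  simp only [ofRestrict, card_of, Nat.card_coe_set_eq]
  rw [← Set.ncard_univ]
  refine (Set.ncard_le_ncard ?_ (Set.toFinite _)).trans (Set.ncard_union_le _ _)
  intro v _
  obtain ⟨w, hw⟩ := hG v
  rcases (h ▸ Set.mem_univ (⟨s(v, w), hw⟩ : G.edgeSet) : _ ∈ A ∪ B) with h | h
  · exact Or.inl ⟨_, h, Sym2.mem_mk_left v w⟩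
  · exact Or.inr ⟨_, h, Sym2.mem_mk_left v w⟩

end FinGraph

namespace FinGraphNo

open FinGraph

theorem finite_card_le (n : ℕ) : {τ : FinGraphNo | (τ : FinGraph).card ≤ n}.Finite :=
  (FinGraph.finite_card_le n).preimage Subtype.val_injective.injOn

/-- The divided powers coproduct on graphs without isolated vertices. -/
def coDP (τ : FinGraphNo) : (FinGraphNo →₀ ℝ) ⊗[ℝ] (FinGraphNo →₀ ℝ) := coDPProd τ.components

theorem card_sum_components (τ : FinGraphNo) :
    (τ.components.sum : FinGraph).card = (τ : FinGraph).card := by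
  rw [← FinGraph.card_sum_components τ, AddSubmonoid.coe_multiset_sum, components,
    Multiset.map_pmap, Multiset.pmap_eq_map, Multiset.map_id']

theorem map_components (τ : FinGraphNo) :
    τ.components.map Subtype.val = (τ : FinGraph).components := by
  rw [components, Multiset.map_pmap, Multiset.pmap_eq_map, Multiset.map_id']

theorem coDP_connected {τ : FinGraphNo} (h : (τ : FinGraph).Connected) :
    coDP τ = gr τ ⊗ₜ[ℝ] gr 0 + gr 0 ⊗ₜ[ℝ] gr τ := by
  have : τ.components = {τ} := Multiset.map_injective Subtype.val_injective <| by
    rw [map_components, components_connected h, Multiset.map_singleton]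
  rw [coDP, this, coDPProd_singleton]

theorem coDP_zero : coDP 0 = gr 0 ⊗ₜ[ℝ] gr 0 := by
  have : (0 : FinGraphNo).components = 0 := Multiset.map_injective Subtype.val_injective <| by
    rw [map_components, ZeroMemClass.coe_zero, components_zero, Multiset.map_zero]
  rw [coDP, this, coDPProd_zero]

theorem coDP_add (σ τ : FinGraphNo) :
    coDP (σ + τ) = TensorProduct.map₂ disjProduct disjProduct (coDP σ) (coDP τ) := by
  have : (σ + τ).components = σ.components + τ.components :=
    Multiset.map_injective Subtype.val_injective <| by
      rw [map_components, AddSubmonoid.coe_add, components_add, Multiset.map_add, map_components,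
        map_components]
  rw [coDP, this, coDPProd_add, coDP, coDP]

theorem dualizable_coDP : Dualizable coDP := fun σ τ =>
  (finite_card_le ((σ : FinGraph).card + (τ : FinGraph).card)).subset fun γ h => by
    have := exists_of_pairing_coDPProd h
    rw [Set.mem_ofPred_eq, ← card_sum_components γ, ← this, AddSubmonoid.coe_add, card_add]

/-- The edge-restricted co-shuffle on graphs without isolated vertices. -/
def coShuffle (τ : FinGraphNo) : (FinGraphNo →₀ ℝ) ⊗[ℝ] (FinGraphNo →₀ ℝ) := coEdgeShuffle τ

/-- The edge-restricted co-quasi-shuffle on graphs without isolated vertices. -/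
def coQuasiShuffle (τ : FinGraphNo) : (FinGraphNo →₀ ℝ) ⊗[ℝ] (FinGraphNo →₀ ℝ) :=
  coEdgeQuasiShuffle τ

theorem dualizable_coShuffle : Dualizable coShuffle := fun σ τ =>
  (finite_card_le ((σ : FinGraph).card + (τ : FinGraph).card)).subset fun γ h => by
    obtain ⟨γ, hγ⟩ := γ
    induction γ using ind with | h n G =>
    rw [Set.mem_ofPred_eq, coShuffle, coEdgeShuffle_of] at h
    obtain ⟨A, B, hAB, rfl, rfl⟩ := exists_of_pairing_coShuffleSum h
    exact card_le_of_restrict ((noIsolated_of G).1 hγ) hAB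

theorem dualizable_coQuasiShuffle : Dualizable coQuasiShuffle := fun σ τ =>
  (finite_card_le ((σ : FinGraph).card + (τ : FinGraph).card)).subset fun γ h => by
    obtain ⟨γ, hγ⟩ := γ
    induction γ using ind with | h n G =>
    rw [Set.mem_ofPred_eq, coQuasiShuffle, coEdgeQuasiShuffle_of] at h
    obtain ⟨A, B, hAB, rfl, rfl⟩ := exists_of_pairing_coQuasiShuffleSum h
    exact card_le_of_restrict ((noIsolated_of G).1 hγ) hAB

end FinGraphNo

/-- A bilinear product. -/
abbrev BilinProduct (X : Type) : Type := (X →₀ ℝ) →ₗ[ℝ] (X →₀ ℝ) →ₗ[ℝ] (X →₀ ℝ)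

namespace FinGraph

/-- The divided powers product. -/
def dpProduct : BilinProduct FinGraph := dualProduct coDP dualizable_coDP

/-- The (vertex-)induced shuffle product. -/
def inducedShuffle : BilinProduct FinGraph :=
  dualProduct coInducedShuffle dualizable_coInducedShuffle

/-- The (vertex-)induced quasi-shuffle product. -/
def inducedQuasiShuffle : BilinProduct FinGraph :=
  dualProduct coInducedQuasiShuffle dualizable_coInducedQuasiShuffle

theorem noIsolated_of_induce {V : Type} [Finite V] {G : SimpleGraph V} {A B : Set V}
    (h : A ∪ B = Set.univ) (hA : (of (G.induce A)).NoIsolated)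
    (hB : (of (G.induce B)).NoIsolated) : (of G).NoIsolated := by
  rw [noIsolated_of] at *
  intro v
  rcases (h ▸ Set.mem_univ v : v ∈ A ∪ B) with h | h
  · exact (hA ⟨v, h⟩).imp' _ fun w hw => hw
  · exact (hB ⟨v, h⟩).imp' _ fun w hw => hw

end FinGraph

namespace FinGraphNo

open FinGraph

/-- The divided powers product on graphs without isolated vertices. -/
def dpProduct : BilinProduct FinGraphNo := dualProduct coDP dualizable_coDP

/-- The (edge-restricted) shuffle product. -/
def shuffle : BilinProduct FinGraphNo := dualProduct coShuffle dualizable_coShuffle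

/-- The (edge-restricted) quasi-shuffle product. -/
def quasiShuffle : BilinProduct FinGraphNo := dualProduct coQuasiShuffle dualizable_coQuasiShuffle

/-- The restriction to graphs without isolated vertices of a product `m` on all graphs. -/
def restrictProduct (m : BilinProduct FinGraph) : BilinProduct FinGraphNo :=
  bilinExt fun σ τ => (m (gr (σ : FinGraph)) (gr (τ : FinGraph))).subtypeDomain (· ∈ noIsolated)

/-- The induced shuffle product, restricted to graphs without isolated vertices. -/
def inducedShuffle : BilinProduct FinGraphNo := restrictProduct FinGraph.inducedShuffle

/-- The induced quasi-shuffle product, restricted to graphs without isolated vertices. -/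
def inducedQuasiShuffle : BilinProduct FinGraphNo := restrictProduct FinGraph.inducedQuasiShuffle

theorem incl_restrictProduct {m : BilinProduct FinGraph}
    (hm : ∀ σ τ : FinGraphNo, ∀ γ, m (gr (σ : FinGraph)) (gr (τ : FinGraph)) γ ≠ 0 → γ ∈ noIsolated)
    (x y : FinGraphNo →₀ ℝ) :
    Finsupp.lmapDomain ℝ ℝ Subtype.val (restrictProduct m x y) =
      m (Finsupp.lmapDomain ℝ ℝ Subtype.val x) (Finsupp.lmapDomain ℝ ℝ Subtype.val y) := by
  induction x using Finsupp.induction_linear with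
  | zero => simp
  | add f g hf hg => simp only [map_add, LinearMap.add_apply, hf, hg]
  | single σ r =>
    induction y using Finsupp.induction_linear with
    | zero => simp
    | add f g hf hg => simp only [map_add, hf, hg]
    | single τ t =>
      rw [← mul_one r, ← mul_one t, ← smul_eq_mul, ← smul_eq_mul, ← Finsupp.smul_single,
        ← Finsupp.smul_single]
      simp only [map_smul, LinearMap.smul_apply]
      congr 2
      rw [restrictProduct, bilinExt_gr]
      simp only [Finsupp.lmapDomain_apply, Finsupp.mapDomain_single]
      ext γ
      by_cases hγ : γ ∈ noIsolated
      · exact Finsupp.mapDomain_apply Subtype.val_injective _ (⟨γ, hγ⟩ : FinGraphNo)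
      · rw [Finsupp.mapDomain_of_notMem_range _ _ (by simpa using hγ)]
        by_contra h
        exact hγ (hm σ τ γ (Ne.symm h))

/-- The restricted induced shuffle agrees with the induced shuffle of all graphs. -/
theorem incl_inducedShuffle (x y : FinGraphNo →₀ ℝ) :
    Finsupp.lmapDomain ℝ ℝ Subtype.val (inducedShuffle x y) =
      FinGraph.inducedShuffle (Finsupp.lmapDomain ℝ ℝ Subtype.val x)
        (Finsupp.lmapDomain ℝ ℝ Subtype.val y) := by
  refine incl_restrictProduct (fun σ τ γ h => ?_) x y
  rw [FinGraph.inducedShuffle, dualProduct_gr_apply] at h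
  obtain ⟨σ, hσ⟩ := σ
  obtain ⟨τ, hτ⟩ := τ
  induction γ using ind with | h n G =>
  rw [coInducedShuffle_of] at h
  obtain ⟨A, B, hAB, rfl, rfl⟩ := exists_of_pairing_coShuffleSum h
  exact noIsolated_of_induce hAB hσ hτ

/-- The restricted induced quasi-shuffle agrees with the induced quasi-shuffle of all graphs. -/
theorem incl_inducedQuasiShuffle (x y : FinGraphNo →₀ ℝ) :
    Finsupp.lmapDomain ℝ ℝ Subtype.val (inducedQuasiShuffle x y) =
      FinGraph.inducedQuasiShuffle (Finsupp.lmapDomain ℝ ℝ Subtype.val x)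
        (Finsupp.lmapDomain ℝ ℝ Subtype.val y) := by
  refine incl_restrictProduct (fun σ τ γ h => ?_) x y
  rw [FinGraph.inducedQuasiShuffle, dualProduct_gr_apply] at h
  obtain ⟨σ, hσ⟩ := σ
  obtain ⟨τ, hτ⟩ := τ
  induction γ using ind with | h n G =>
  rw [coInducedQuasiShuffle_of] at h
  obtain ⟨A, B, hAB, rfl, rfl⟩ := exists_of_pairing_coQuasiShuffleSum h
  exact noIsolated_of_induce hAB hσ hτ

end FinGraphNo

/-! ### Hopf algebras -/

/-- The structure maps of a (prospective) real Hopf algebra on a vector space. -/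
structure HopfData (W : Type) [AddCommGroup W] [Module ℝ W] where
  mul : W →ₗ[ℝ] W →ₗ[ℝ] W
  one : W
  comul : W →ₗ[ℝ] W ⊗[ℝ] W
  counit : W →ₗ[ℝ] ℝ

namespace HopfData

variable {W : Type} [AddCommGroup W] [Module ℝ W]

/-- The structure maps satisfy the axioms of a commutative Hopf algebra. -/
class IsHopf (D : HopfData W) : Prop where
  mul_assoc : ∀ x y z, D.mul (D.mul x y) z = D.mul x (D.mul y z)
  mul_comm : ∀ x y, D.mul x y = D.mul y x
  one_mul : ∀ x, D.mul D.one x = x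
  coassoc : TensorProduct.assoc ℝ W W W ∘ₗ D.comul.rTensor W ∘ₗ D.comul =
    D.comul.lTensor W ∘ₗ D.comul
  counit_left : ∀ x, D.counit.rTensor W (D.comul x) = 1 ⊗ₜ[ℝ] x
  counit_right : ∀ x, D.counit.lTensor W (D.comul x) = x ⊗ₜ[ℝ] 1
  counit_one : D.counit D.one = 1
  counit_mul : ∀ x y, D.counit (D.mul x y) = D.counit x * D.counit y
  comul_one : D.comul D.one = D.one ⊗ₜ[ℝ] D.one
  comul_mul : ∀ x y, D.comul (D.mul x y) = TensorProduct.map₂ D.mul D.mul (D.comul x) (D.comul y)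
  antipode : ∃ S : W →ₗ[ℝ] W, ∀ x,
    TensorProduct.lift D.mul (S.rTensor W (D.comul x)) = D.counit x • D.one ∧
    TensorProduct.lift D.mul (S.lTensor W (D.comul x)) = D.counit x • D.one

/-- The vector space `W`, to be equipped with the structure maps in `D`. -/
def Carrier (_ : HopfData W) : Type := W

/-- An element of `W`, as an element of `D.Carrier`. -/
def toCarrier (D : HopfData W) (x : W) : D.Carrier := x

variable (D : HopfData W)

instance : AddCommGroup D.Carrier := inferInstanceAs (AddCommGroup W)

instance [h : D.IsHopf] : CommRing D.Carrier where
  __ := (inferInstance : AddCommGroup D.Carrier)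
  mul x y := D.mul x y
  one := D.one
  mul_assoc := h.mul_assoc
  mul_comm := h.mul_comm
  one_mul := h.one_mul
  mul_one x := (h.mul_comm x D.one).trans (h.one_mul x)
  left_distrib x y z := map_add (D.mul x) y z
  right_distrib x y z := LinearMap.map_add₂ D.mul x y z
  zero_mul x := LinearMap.map_zero₂ D.mul x
  mul_zero x := map_zero (D.mul x)

instance : Module ℝ D.Carrier := inferInstanceAs (Module ℝ W)

instance [h : D.IsHopf] : Algebra ℝ D.Carrier :=
  Algebra.ofModule (fun r x y => LinearMap.map_smul₂ D.mul r x y) (fun r x y => map_smul (D.mul x) r y)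

instance [h : D.IsHopf] : Coalgebra ℝ D.Carrier where
  comul := D.comul
  counit := D.counit
  coassoc := h.coassoc
  rTensor_counit_comp_comul := LinearMap.ext h.counit_left
  lTensor_counit_comp_comul := LinearMap.ext h.counit_right

theorem map₂_mul [h : D.IsHopf] (a b : D.Carrier ⊗[ℝ] D.Carrier) :
    TensorProduct.map₂ (LinearMap.mul ℝ D.Carrier) (LinearMap.mul ℝ D.Carrier) a b = a * b := by
  induction a using TensorProduct.induction_on with
  | zero => simp
  | add x y hx hy => simp [add_mul, hx, hy]
  | tmul x y =>
    induction b using TensorProduct.induction_on with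
    | zero => simp
    | add z w hz hw => rw [map_add, hz, hw, mul_add]
    | tmul z w => simp

instance [h : D.IsHopf] : Bialgebra ℝ D.Carrier :=
  Bialgebra.mk' ℝ D.Carrier h.counit_one (fun {a b} => h.counit_mul a b) h.comul_one
    (fun {a b} => (h.comul_mul a b).trans (D.map₂_mul _ _))

instance [h : D.IsHopf] : HopfAlgebra ℝ D.Carrier where
  antipode := h.antipode.choose
  mul_antipode_rTensor_comul := LinearMap.ext fun x =>
    ((h.antipode.choose_spec x).1.trans (Algebra.algebraMap_eq_smul_one (A := D.Carrier) _).symm :)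
  mul_antipode_lTensor_comul := LinearMap.ext fun x =>
    ((h.antipode.choose_spec x).2.trans (Algebra.algebraMap_eq_smul_one (A := D.Carrier) _).symm :)

end HopfData

/-- The structure maps `(⊔, Δ)` on the free vector space on `X`, where the coproduct `Δ` is given on
basis vectors; the unit is the empty graph. -/
abbrev symHopf {X : Type} [AddCommMonoid X] (Δ : X → (X →₀ ℝ) ⊗[ℝ] (X →₀ ℝ)) :
    HopfData (X →₀ ℝ) where
  mul := disjProduct
  one := gr 0
  comul := linExt Δ
  counit := counitMap

/-- The structure maps `(m, Δ_⊔)` on the free vector space on `X`; the unit is the empty graph. -/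
abbrev dualHopf {X : Type} [AddCommMonoid X] [Finset.HasAntidiagonal X] (m : BilinProduct X) :
    HopfData (X →₀ ℝ) where
  mul := m
  one := gr 0
  comul := linExt coDisj
  counit := counitMap
end

/-!
Both Hopf algebras are symmetric algebras on the vector space spanned by the connected graphs, and
`Ψ` is the identification of the two.

Call a bialgebra structure on `ℝ⟨X⟩` primitively generated if the connected graphs are primitive and
its product is triangular: up to a nonzero factor, the leading term of the product of `σ` and `τ` is
`σ ⊔ τ`, and all other terms have fewer connected components (`IsTriangularProduct`). A product of
connected graphs then has the disjoint union of these graphs as leading term. Since a graph is the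
disjoint union of a unique multiset of connected graphs, the matrix expressing monomials in the
connected graphs by graphs is triangular, hence invertible: the connected graphs are free generators
(`Decomposition.exists_polyEquiv`). So `ℝ⟨X⟩` is the polynomial algebra on primitive generators,
which is the symmetric algebra with its usual coproduct. The remaining Hopf algebra axioms, in
particular the antipode, are transported from there (`HopfData.Model.isHopf`), and two primitively
generated structures on `ℝ⟨X⟩` are isomorphic by a map fixing the connected graphs
(`HopfData.IsPrimitivelyGenerated.exists_bialgEquiv`).

For `(⊔, Δ_DP)` all this is immediate. For `(†, Δ_⊔)` it is obtained by duality
(`IsGoodCoproduct.isGoodProduct`): with respect to the pairing `†` is adjoint to `Δ_†`, and `Δ_⊔` is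
adjoint to `⊔`. Therefore `†` is associative and commutative because `Δ_†` is coassociative and
cocommutative, `Δ_⊔` is multiplicative for `†` because `Δ_†` is multiplicative for `⊔`, and `†` is
triangular if `σ ⊗ τ` occurs in `Δ_†(γ)` for `γ = σ ⊔ τ`, and otherwise only for graphs `γ` with fewer
components than `σ ⊔ τ`.

The shuffle and quasi-shuffle coproducts are sums over the covers of a finite ground set by two
subsets, disjoint in the case of the shuffles; the ground set consists of the vertices or of the
edges of a graph. Both kinds are treated at once, by means of the axioms of a `RestrictionSystem`.
Their triangularity is `FinGraph.of_eq_add_or_rank_lt`: if the subgraphs on `A` and on `B` cover `γ`,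
their disjoint union maps onto `γ`, so it has at least as many components, and with equality only if
this map is an isomorphism. Finally, the induced products on graphs without isolated vertices are
restrictions of those on all graphs (`IsGoodProduct.restrict`).
-/

noncomputable section

/-! ### Triangular endomorphisms and products on a free vector space -/

@[elab_as_elim]
theorem free_induction {X : Type} [Zero X] {p : (X →₀ ℝ) → Prop} (x : X →₀ ℝ) (gr : ∀ σ, p (gr σ))
    (add : ∀ x y, p x → p y → p (x + y)) (smul : ∀ (r : ℝ) x, p x → p (r • x)) : p x := by
  induction x using Finsupp.induction_linear with
  | zero => simpa using smul 0 _ (gr 0)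
  | add x y hx hy => exact add x y hx hy
  | single σ r => simpa using smul r _ (gr σ)

theorem apply_eq_sum_support {X Y : Type} (L : (X →₀ ℝ) →ₗ[ℝ] (Y →₀ ℝ)) (x : X →₀ ℝ) (γ : Y) :
    L x γ = ∑ σ ∈ x.support, x σ * L (gr σ) γ := by
  conv_lhs => rw [← Finsupp.sum_single x, Finsupp.sum]
  rw [map_sum, Finsupp.finsetSum_apply]
  refine Finset.sum_congr rfl fun σ _ => ?_
  rw [← Finsupp.smul_single_one, map_smul, Finsupp.smul_apply, smul_eq_mul]

/-- A linear map which is triangular with nonzero diagonal entries, with respect to a rank function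
with values in `ℕ`, is bijective. The basis need not be finite. -/
theorem bijective_of_triangular {X : Type} (k : X → ℕ) (L : (X →₀ ℝ) →ₗ[ℝ] (X →₀ ℝ))
    (hlt : ∀ σ γ, L (gr σ) γ ≠ 0 → γ = σ ∨ k γ < k σ) (hdiag : ∀ σ, L (gr σ) σ ≠ 0) :
    Function.Bijective L := by
  classical
  constructor
  · rw [← LinearMap.ker_eq_bot, LinearMap.ker_eq_bot']
    intro x hx
    by_contra hne
    -- compare coefficients at a basis vector of maximal rank in the support
    obtain ⟨γ, hγ, hmax⟩ := x.support.exists_max_image k (Finsupp.support_nonempty_iff.2 hne)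
    have h1 := apply_eq_sum_support L x γ
    rw [hx, Finset.sum_eq_single γ] at h1
    · exact mul_ne_zero (Finsupp.mem_support_iff.1 hγ) (hdiag γ) h1.symm
    · intro σ hσ hne
      by_contra h
      rcases hlt σ γ (right_ne_zero_of_mul h) with h | h
      · exact hne h.symm
      · exact absurd (hmax σ hσ) (by omega)
    · exact fun h => absurd hγ h
  · have key : ∀ n, ∀ σ, k σ = n → gr σ ∈ LinearMap.range L := by
      -- induction on the rank: `L (gr σ)` is a multiple of `gr σ` up to terms of smaller rank
      intro n
      induction n using Nat.strong_induction_on with | _ n ih =>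
      rintro σ rfl
      have hrest : L (gr σ) - L (gr σ) σ • gr σ ∈ LinearMap.range L := by
        rw [← Finsupp.sum_single (L (gr σ) - L (gr σ) σ • gr σ)]
        refine Submodule.sum_mem _ fun γ hγ => ?_
        rw [← Finsupp.smul_single_one]
        rw [Finsupp.mem_support_iff] at hγ
        have hne : γ ≠ σ := by
          rintro rfl
          simp at hγ
        have hγ' : L (gr σ) γ ≠ 0 := by
          simpa [Finsupp.single_eq_of_ne hne] using hγ
        exact Submodule.smul_mem _ _ (ih _ ((hlt σ γ hγ').resolve_left hne) γ rfl)
      have h := Submodule.sub_mem _ (LinearMap.mem_range_self L (gr σ)) hrest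
      rw [sub_sub_cancel] at h
      exact (Submodule.smul_mem_iff _ (hdiag σ)).1 h
    intro x
    rw [← LinearMap.mem_range, ← Finsupp.sum_single x]
    refine Submodule.sum_mem _ fun γ _ => ?_
    rw [← Finsupp.smul_single_one]
    exact Submodule.smul_mem _ _ (key _ γ rfl)

/-- A bilinear product on the free vector space on `X` is a commutative product with unit `0 : X`
which agrees with the addition of `X` up to a nonzero factor and terms of smaller rank `k`. -/
structure IsTriangularProduct {X : Type} [AddCommMonoid X] (k : X → ℕ) (m : BilinProduct X) :
    Prop where
  assoc : ∀ x y z, m (m x y) z = m x (m y z)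
  comm : ∀ x y, m x y = m y x
  one_mul : ∀ x, m (gr 0) x = x
  eq_or_lt : ∀ σ τ γ, m (gr σ) (gr τ) γ ≠ 0 → γ = σ + τ ∨ k γ < k σ + k τ
  ne_zero : ∀ σ τ, m (gr σ) (gr τ) (σ + τ) ≠ 0

theorem isTriangularProduct_disjProduct {X : Type} [AddCommMonoid X] (k : X → ℕ) :
    IsTriangularProduct k (disjProduct : BilinProduct X) where
  assoc x y z := by
    induction x using free_induction with
    | add x y hx hy => simp only [map_add, LinearMap.add_apply, hx, hy]
    | smul r x hx => simp only [map_smul, LinearMap.smul_apply, hx]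
    | gr a =>
    induction y using free_induction with
    | add x y hx hy => simp only [map_add, LinearMap.add_apply, hx, hy]
    | smul r x hx => simp only [map_smul, LinearMap.smul_apply, hx]
    | gr b =>
    induction z using free_induction with
    | add x y hx hy => simp only [map_add, hx, hy]
    | smul r x hx => simp only [map_smul, hx]
    | gr c => simp only [disjProduct, bilinExt_gr, add_assoc]
  comm x y := by
    refine LinearMap.congr_fun₂ (f := disjProduct) (g := disjProduct.flip) ?_ x y
    ext σ τ : 4
    simp [disjProduct, add_comm]
  one_mul x := by
    refine LinearMap.congr_fun (f := disjProduct (gr 0)) (g := LinearMap.id) ?_ x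
    ext σ : 2
    simp [disjProduct]
  eq_or_lt σ τ γ h := by
    rw [disjProduct, bilinExt_gr, Finsupp.single_apply_ne_zero] at h
    exact Or.inl h.1
  ne_zero σ τ := by simp [disjProduct]

/-! ### Products for which a multiset of generators is free -/

/-- Unique decomposition of the elements of a commutative monoid into elements satisfying `Conn`. -/
structure Decomposition (X : Type) [AddCommMonoid X] where
  /-- the indecomposable elements -/
  Conn : X → Prop
  /-- the multiset of indecomposable summands -/
  comp : X → Multiset X
  comp_add : ∀ σ τ, comp (σ + τ) = comp σ + comp τ
  comp_sum : ∀ τ, (comp τ).sum = τ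
  comp_conn : ∀ τ, Conn τ → comp τ = {τ}
  conn_of_mem : ∀ τ, ∀ c ∈ comp τ, Conn c

namespace Decomposition

variable {X : Type} [AddCommMonoid X] (K : Decomposition X)

/-- The number of indecomposable summands. -/
def rank (τ : X) : ℕ := (K.comp τ).card

theorem comp_zero : K.comp 0 = 0 := by simpa using K.comp_add 0 0

theorem rank_add (σ τ : X) : K.rank (σ + τ) = K.rank σ + K.rank τ := by
  simp [rank, K.comp_add]

theorem rank_conn {τ : X} (h : K.Conn τ) : K.rank τ = 1 := by simp [rank, K.comp_conn τ h]

theorem eq_zero_of_rank {τ : X} (h : K.rank τ = 0) : τ = 0 := by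
  rw [← K.comp_sum τ, Multiset.card_eq_zero.1 h, Multiset.sum_zero]

theorem comp_multiset_sum (t : Multiset {c // K.Conn c}) :
    K.comp (t.map Subtype.val).sum = t.map Subtype.val := by
  induction t using Multiset.induction with
  | empty => simp [K.comp_zero]
  | cons a t ih => simp [K.comp_add, ih, K.comp_conn _ a.2]

/-- `X` is the free commutative monoid on its indecomposable elements. -/
def equivFinsupp : ({c // K.Conn c} →₀ ℕ) ≃ X :=
  Equiv.ofBijective (fun s => ((Finsupp.toMultiset s).map Subtype.val).sum) <| by
    classical
    constructor
    · intro s t h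
      have h := congrArg K.comp h
      simp only [comp_multiset_sum] at h
      exact Multiset.toFinsupp.symm.injective (Multiset.map_injective Subtype.val_injective h)
    · intro τ
      refine ⟨Multiset.toFinsupp ((K.comp τ).pmap Subtype.mk (K.conn_of_mem τ)), ?_⟩
      simp [Multiset.map_pmap, Multiset.pmap_eq_map, K.comp_sum]

/-- The algebra structure on the free vector space on `X` with product `m`. -/
def ProdAlg {k : X → ℕ} {m : BilinProduct X} (_ : IsTriangularProduct k m) : Type := X →₀ ℝ

section ProdAlg

variable {k : X → ℕ} {m : BilinProduct X} (hm : IsTriangularProduct k m)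

instance : AddCommGroup (ProdAlg hm) := inferInstanceAs (AddCommGroup (X →₀ ℝ))

instance : Module ℝ (ProdAlg hm) := inferInstanceAs (Module ℝ (X →₀ ℝ))

instance : CommRing (ProdAlg hm) where
  __ := (inferInstance : AddCommGroup (ProdAlg hm))
  mul x y := m x y
  one := gr (0 : X)
  mul_assoc := hm.assoc
  mul_comm := hm.comm
  one_mul := hm.one_mul
  mul_one x := (hm.comm x _).trans (hm.one_mul x)
  left_distrib x y z := map_add (m x) y z
  right_distrib x y z := LinearMap.map_add₂ m x y z
  zero_mul x := LinearMap.map_zero₂ m x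
  mul_zero x := map_zero (m x)

instance : Algebra ℝ (ProdAlg hm) :=
  Algebra.ofModule (fun r x y => LinearMap.map_smul₂ m r x y) (fun r x y => map_smul (m x) r y)

/-- A basis vector, as an element of the algebra with product `m`. -/
def ProdAlg.of (τ : X) : ProdAlg hm := gr τ

/-- The coefficients of an element of the algebra with product `m`. -/
def ProdAlg.coeff : ProdAlg hm →ₗ[ℝ] (X →₀ ℝ) := LinearMap.id

end ProdAlg

/-- A product of indecomposable elements is triangular: its leading term is their sum. -/
theorem prod_triangular {m : BilinProduct X} (hm : IsTriangularProduct K.rank m)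
    (t : Multiset {c // K.Conn c}) :
    (∀ γ, ProdAlg.coeff hm (t.map fun c => ProdAlg.of hm c.1).prod γ ≠ 0 →
      γ = (t.map Subtype.val).sum ∨ K.rank γ < t.card) ∧
    ProdAlg.coeff hm (t.map fun c => ProdAlg.of hm c.1).prod (t.map Subtype.val).sum ≠ 0 := by
  induction t using Multiset.induction with
  | empty =>
    have h1 : ProdAlg.coeff hm
        ((0 : Multiset {c // K.Conn c}).map fun c => ProdAlg.of hm c.1).prod = gr 0 := rfl
    rw [h1]
    refine ⟨fun γ hγ => ?_, by simp⟩
    rw [Finsupp.single_apply_ne_zero] at hγ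
    exact Or.inl (by simpa using hγ.1)
  | cons a t ih =>
    set x : X →₀ ℝ := ProdAlg.coeff hm (t.map fun c => ProdAlg.of hm c.1).prod
    have hrank : K.rank (t.map Subtype.val).sum = t.card := by
      rw [rank, comp_multiset_sum, Multiset.card_map]
    have h1 : ProdAlg.coeff hm ((a ::ₘ t).map fun c => ProdAlg.of hm c.1).prod = m (gr a.1) x := by
      rw [Multiset.map_cons, Multiset.prod_cons]; rfl
    have h2 := apply_eq_sum_support (m (gr a.1)) x
    rw [h1, Multiset.map_cons, Multiset.sum_cons, Multiset.card_cons]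
    constructor
    · intro γ hγ
      rw [h2] at hγ
      obtain ⟨τ, -, hτ⟩ := Finset.exists_ne_zero_of_sum_ne_zero hγ
      have h3 := ih.1 τ (left_ne_zero_of_mul hτ)
      have h4 := hm.eq_or_lt _ _ _ (right_ne_zero_of_mul hτ)
      rw [K.rank_conn a.2] at h4
      rcases h3 with rfl | h3
      · rw [hrank] at h4
        exact h4.imp_right (by omega)
      · rcases h4 with rfl | h4
        · rw [K.rank_add, K.rank_conn a.2]
          omega
        · omega
    · rw [h2, Finset.sum_eq_single (t.map Subtype.val).sum]
      · exact mul_ne_zero ih.2 (hm.ne_zero _ _)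
      · intro τ _ hne
        by_contra h
        have h3 := (ih.1 τ (left_ne_zero_of_mul h)).resolve_left hne
        rcases hm.eq_or_lt _ _ _ (right_ne_zero_of_mul h) with h4 | h4
        · have := congrArg K.rank h4
          rw [K.rank_add, K.rank_add, hrank] at this
          omega
        · rw [K.rank_add, K.rank_conn a.2, hrank] at h4
          omega
      · intro h
        exact absurd (Finsupp.notMem_support_iff.1 h) ih.2

/-- The indecomposable elements freely generate the algebra with a triangular product. -/
theorem exists_polyEquiv {m : BilinProduct X} (hm : IsTriangularProduct K.rank m) :
    ∃ f : MvPolynomial {c // K.Conn c} ℝ ≃ₗ[ℝ] (X →₀ ℝ), f 1 = gr 0 ∧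
      (∀ p q, f (p * q) = m (f p) (f q)) ∧ ∀ c, f (MvPolynomial.X c) = gr c.1 := by
  let F : MvPolynomial {c // K.Conn c} ℝ →ₐ[ℝ] ProdAlg hm :=
    MvPolynomial.aeval fun c => ProdAlg.of hm c.1
  let F' : MvPolynomial {c // K.Conn c} ℝ →ₗ[ℝ] (X →₀ ℝ) := ProdAlg.coeff hm ∘ₗ F.toLinearMap
  let b := (MvPolynomial.basisMonomials {c // K.Conn c} ℝ).reindex K.equivFinsupp
  have hb : ∀ τ, F' (b.repr.symm (gr τ)) =
      ProdAlg.coeff hm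
        ((Finsupp.toMultiset (K.equivFinsupp.symm τ)).map fun c => ProdAlg.of hm c.1).prod := by
    intro τ
    rw [Module.Basis.repr_symm_single_one, Module.Basis.reindex_apply,
      MvPolynomial.coe_basisMonomials]
    refine congrArg (ProdAlg.coeff hm) ?_
    change F _ = _
    rw [MvPolynomial.aeval_monomial, map_one, one_mul, Finsupp.toMultiset_map,
      Finsupp.prod_toMultiset, Finsupp.prod_mapDomain_index (fun _ => pow_zero _) fun _ _ _ => pow_add _ _ _]
  have hτ : ∀ τ, ((Finsupp.toMultiset (K.equivFinsupp.symm τ)).map Subtype.val).sum = τ :=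
    K.equivFinsupp.apply_symm_apply
  have hcard : ∀ τ, (Finsupp.toMultiset (K.equivFinsupp.symm τ)).card = K.rank τ := fun τ => by
    conv_rhs => rw [← hτ τ, rank, comp_multiset_sum, Multiset.card_map]
  have hbij : Function.Bijective (F' ∘ₗ b.repr.symm.toLinearMap) := by
    refine bijective_of_triangular K.rank _ (fun σ γ h => ?_) fun σ => ?_
    · have h : F' (b.repr.symm (gr σ)) γ ≠ 0 := h
      rw [hb] at h
      have := (K.prod_triangular hm (Finsupp.toMultiset (K.equivFinsupp.symm σ))).1 γ h
      rwa [hτ, hcard] at this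
    · change F' (b.repr.symm (gr σ)) σ ≠ 0
      rw [hb]
      have := (K.prod_triangular hm (Finsupp.toMultiset (K.equivFinsupp.symm σ))).2
      rwa [hτ] at this
  have hbij' : Function.Bijective F' :=
    (Function.Bijective.of_comp_iff F' b.repr.symm.bijective).1 hbij
  refine ⟨LinearEquiv.ofBijective F' hbij', congrArg (ProdAlg.coeff hm) (map_one F),
    fun p q => congrArg (ProdAlg.coeff hm) (map_mul F p q), fun c => ?_⟩
  exact congrArg (ProdAlg.coeff hm) (MvPolynomial.aeval_X _ c)

end Decomposition

/-! ### The antipode of the symmetric algebra -/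

/-- An algebra endomorphism which changes the sign of a primitive element is a convolution inverse
of the identity on that element. -/
theorem lift_comul_of_primitive {H : Type} [CommRing H] [Bialgebra ℝ H] {S : H →ₐ[ℝ] H} {x : H}
    (hx : Coalgebra.comul (R := ℝ) x = x ⊗ₜ[ℝ] 1 + 1 ⊗ₜ[ℝ] x) (hS : S x = -x) :
    Algebra.TensorProduct.lift S (.id ℝ H) (fun _ => Commute.all _)
        (Bialgebra.comulAlgHom ℝ H x) = 0 ∧
      Algebra.TensorProduct.lift (.id ℝ H) S (fun _ _ => Commute.all _ _)
        (Bialgebra.comulAlgHom ℝ H x) = 0 := by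
  simp only [Bialgebra.comulAlgHom_apply, hx, map_add]
  constructor <;>
  · erw [Algebra.TensorProduct.lift_tmul, Algebra.TensorProduct.lift_tmul]
    simp [hS]

/-- The symmetric algebra is a Hopf algebra: the antipode changes the sign of the generators. -/
instance symmetricHopf (M : Type) [AddCommGroup M] [Module ℝ M] :
    HopfAlgebra ℝ (SymmetricAlgebra ℝ M) :=
  have key := fun x : M => lift_comul_of_primitive (SymmetricAlgebra.comul_ι ℝ M x)
    (SymmetricAlgebra.lift_ι_apply (-SymmetricAlgebra.ι ℝ M) x)
  have hε : ∀ x : M, (Algebra.ofId ℝ (SymmetricAlgebra ℝ M))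
      (SymmetricAlgebra.algebraMapInv (SymmetricAlgebra.ι ℝ M x)) = 0 := fun x => by
    rw [SymmetricAlgebra.algebraMapInv_ι, map_zero]
  .ofAlgHom (SymmetricAlgebra.lift (-SymmetricAlgebra.ι ℝ M))
    (SymmetricAlgebra.algHom_ext (LinearMap.ext fun x => (key x).1.trans (hε x).symm))
    (SymmetricAlgebra.algHom_ext (LinearMap.ext fun x => (key x).2.trans (hε x).symm))

/-! ### Recognizing Hopf algebras generated by primitive elements -/

theorem TensorProduct.map_mul_of_map_mul {A W : Type} [CommSemiring A] [Algebra ℝ A]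
    [AddCommGroup W] [Module ℝ W] (f : A →ₗ[ℝ] W) (m : W →ₗ[ℝ] W →ₗ[ℝ] W)
    (hf : ∀ p q, f (p * q) = m (f p) (f q)) (u v : A ⊗[ℝ] A) :
    TensorProduct.map f f (u * v) =
      TensorProduct.map₂ m m (TensorProduct.map f f u) (TensorProduct.map f f v) := by
  induction u using TensorProduct.induction_on with
  | zero => simp
  | add x y hx hy => simp only [add_mul, map_add, hx, hy, LinearMap.add_apply]
  | tmul a b =>
    induction v using TensorProduct.induction_on with
    | zero => simp
    | add x y hx hy => simp only [mul_add, map_add, hx, hy]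
    | tmul c d => simp [hf]

namespace HopfData

/-- A linear isomorphism from the Hopf algebra `H` to `W` which takes the structure maps of `H` to
those in `D`. -/
structure Model (H : Type) [CommSemiring H] [HopfAlgebra ℝ H] {W : Type} [AddCommGroup W]
    [Module ℝ W] (D : HopfData W) where
  /-- the underlying linear isomorphism -/
  f : H ≃ₗ[ℝ] W
  map_one : f 1 = D.one
  map_mul : ∀ p q, f (p * q) = D.mul (f p) (f q)
  map_comul : ∀ p, D.comul (f p) =
    TensorProduct.map f.toLinearMap f.toLinearMap (Coalgebra.comul (R := ℝ) p)
  map_counit : ∀ p, D.counit (f p) = Coalgebra.counit (R := ℝ) p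

namespace Model

variable {H : Type} [CommSemiring H] [HopfAlgebra ℝ H] {W : Type} [AddCommGroup W] [Module ℝ W]
  {D : HopfData W}

theorem comm_comul [Coalgebra.IsCocomm ℝ H] (e : Model H D) (x : W) :
    TensorProduct.comm ℝ _ _ (D.comul x) = D.comul x := by
  obtain ⟨p, rfl⟩ := e.f.surjective x
  rw [e.map_comul, ← TensorProduct.map_comm, Coalgebra.comm_comul]

/-- The Hopf algebra axioms are transported along the isomorphism; the antipode is the conjugate of
that of `H`. -/
theorem isHopf (e : Model H D) : D.IsHopf where
  mul_assoc x y z := by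
    obtain ⟨p, rfl⟩ := e.f.surjective x
    obtain ⟨q, rfl⟩ := e.f.surjective y
    obtain ⟨r, rfl⟩ := e.f.surjective z
    simp only [← e.map_mul, mul_assoc]
  mul_comm x y := by
    obtain ⟨p, rfl⟩ := e.f.surjective x
    obtain ⟨q, rfl⟩ := e.f.surjective y
    simp only [← e.map_mul, mul_comm]
  one_mul x := by
    obtain ⟨p, rfl⟩ := e.f.surjective x
    rw [← e.map_one, ← e.map_mul, one_mul]
  coassoc := by
    refine LinearMap.ext fun x => ?_
    obtain ⟨p, rfl⟩ := e.f.surjective x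
    have hco : D.comul ∘ₗ e.f.toLinearMap =
        TensorProduct.map e.f.toLinearMap e.f.toLinearMap ∘ₗ Coalgebra.comul (R := ℝ) :=
      LinearMap.ext e.map_comul
    have h1 : ∀ u, D.comul.rTensor _ (TensorProduct.map e.f.toLinearMap e.f.toLinearMap u) =
        TensorProduct.map (TensorProduct.map e.f.toLinearMap e.f.toLinearMap) e.f.toLinearMap
          ((Coalgebra.comul (R := ℝ)).rTensor _ u) := fun u => by
      rw [LinearMap.rTensor, LinearMap.rTensor, TensorProduct.map_map, TensorProduct.map_map, hco]
      rfl
    have h2 : ∀ u, D.comul.lTensor _ (TensorProduct.map e.f.toLinearMap e.f.toLinearMap u) =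
        TensorProduct.map e.f.toLinearMap (TensorProduct.map e.f.toLinearMap e.f.toLinearMap)
          ((Coalgebra.comul (R := ℝ)).lTensor _ u) := fun u => by
      rw [LinearMap.lTensor, LinearMap.lTensor, TensorProduct.map_map, TensorProduct.map_map, hco]
      rfl
    simp only [LinearMap.comp_apply, e.map_comul, h1, h2, LinearEquiv.coe_coe]
    rw [← Coalgebra.coassoc_apply, TensorProduct.map_map_assoc]
  counit_left x := by
    obtain ⟨p, rfl⟩ := e.f.surjective x
    have hc : D.counit ∘ₗ e.f.toLinearMap = Coalgebra.counit (R := ℝ) :=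
      LinearMap.ext e.map_counit
    have h1 : ∀ u, D.counit.rTensor _ (TensorProduct.map e.f.toLinearMap e.f.toLinearMap u) =
        TensorProduct.map LinearMap.id e.f.toLinearMap
          ((Coalgebra.counit (R := ℝ)).rTensor _ u) := fun u => by
      rw [LinearMap.rTensor, LinearMap.rTensor, TensorProduct.map_map, TensorProduct.map_map, hc]
      rfl
    rw [e.map_comul, h1, Coalgebra.rTensor_counit_comul]
    simp
  counit_right x := by
    obtain ⟨p, rfl⟩ := e.f.surjective x
    have hc : D.counit ∘ₗ e.f.toLinearMap = Coalgebra.counit (R := ℝ) :=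
      LinearMap.ext e.map_counit
    have h1 : ∀ u, D.counit.lTensor _ (TensorProduct.map e.f.toLinearMap e.f.toLinearMap u) =
        TensorProduct.map e.f.toLinearMap LinearMap.id
          ((Coalgebra.counit (R := ℝ)).lTensor _ u) := fun u => by
      rw [LinearMap.lTensor, LinearMap.lTensor, TensorProduct.map_map, TensorProduct.map_map, hc]
      rfl
    rw [e.map_comul, h1, Coalgebra.lTensor_counit_comul]
    simp
  counit_one := by rw [← e.map_one, e.map_counit, Bialgebra.counit_one]
  counit_mul x y := by
    obtain ⟨p, rfl⟩ := e.f.surjective x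
    obtain ⟨q, rfl⟩ := e.f.surjective y
    simp only [← e.map_mul, e.map_counit, Bialgebra.counit_mul]
  comul_one := by
    rw [← e.map_one, e.map_comul, Bialgebra.comul_one, Algebra.TensorProduct.one_def,
      TensorProduct.map_tmul]
    rfl
  comul_mul x y := by
    obtain ⟨p, rfl⟩ := e.f.surjective x
    obtain ⟨q, rfl⟩ := e.f.surjective y
    rw [← e.map_mul, e.map_comul, e.map_comul, e.map_comul, Bialgebra.comul_mul,
      TensorProduct.map_mul_of_map_mul _ _ e.map_mul]
  antipode := by
    let S := HopfAlgebra.antipode ℝ (A := H)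
    refine ⟨e.f.toLinearMap ∘ₗ S ∘ₗ e.f.symm.toLinearMap, fun x => ?_⟩
    obtain ⟨p, rfl⟩ := e.f.surjective x
    have hl : ∀ u, TensorProduct.lift D.mul (TensorProduct.map e.f.toLinearMap e.f.toLinearMap u) =
        e.f (LinearMap.mul' ℝ _ u) := fun u => by
      induction u using TensorProduct.induction_on with
      | zero => simp
      | add x y hx hy => simp only [map_add, hx, hy]
      | tmul a b => simp [e.map_mul]
    have hS : (e.f.toLinearMap ∘ₗ S ∘ₗ e.f.symm.toLinearMap) ∘ₗ e.f.toLinearMap =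
        e.f.toLinearMap ∘ₗ S := LinearMap.ext fun p => by simp
    have h1 : ∀ u, (e.f.toLinearMap ∘ₗ S ∘ₗ e.f.symm.toLinearMap).rTensor _
        (TensorProduct.map e.f.toLinearMap e.f.toLinearMap u) =
        TensorProduct.map e.f.toLinearMap e.f.toLinearMap (S.rTensor _ u) := fun u => by
      rw [LinearMap.rTensor, LinearMap.rTensor, TensorProduct.map_map, TensorProduct.map_map, hS]
      rfl
    have h2 : ∀ u, (e.f.toLinearMap ∘ₗ S ∘ₗ e.f.symm.toLinearMap).lTensor _
        (TensorProduct.map e.f.toLinearMap e.f.toLinearMap u) =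
        TensorProduct.map e.f.toLinearMap e.f.toLinearMap (S.lTensor _ u) := fun u => by
      rw [LinearMap.lTensor, LinearMap.lTensor, TensorProduct.map_map, TensorProduct.map_map, hS]
      rfl
    rw [e.map_comul, h1, h2, hl, hl, e.map_counit, HopfAlgebra.mul_antipode_rTensor_comul_apply,
      HopfAlgebra.mul_antipode_lTensor_comul_apply, Algebra.algebraMap_eq_smul_one, map_smul,
      e.map_one]
    exact ⟨rfl, rfl⟩

end Model

/-- The product is triangular, coproduct and counit are multiplicative and unital, and the
indecomposable elements are primitive. Coassociativity and counitality need not be required: they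
follow, see `exists_model`. -/
structure IsPrimitivelyGenerated {X : Type} [AddCommMonoid X] (K : Decomposition X)
    (D : HopfData (X →₀ ℝ)) : Prop where
  triangular : IsTriangularProduct K.rank D.mul
  one_eq : D.one = gr 0
  comul_one : D.comul D.one = D.one ⊗ₜ[ℝ] D.one
  comul_mul : ∀ x y, D.comul (D.mul x y) = TensorProduct.map₂ D.mul D.mul (D.comul x) (D.comul y)
  counit_one : D.counit D.one = 1
  counit_mul : ∀ x y, D.counit (D.mul x y) = D.counit x * D.counit y
  comul_conn : ∀ c, K.Conn c → D.comul (gr c) = gr c ⊗ₜ[ℝ] gr 0 + gr 0 ⊗ₜ[ℝ] gr c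
  counit_conn : ∀ c, K.Conn c → D.counit (gr c) = 0

namespace IsPrimitivelyGenerated

variable {X : Type} [AddCommMonoid X] {K : Decomposition X} {D : HopfData (X →₀ ℝ)}

/-- A primitively generated structure is that of the symmetric algebra on the space spanned by the
indecomposable elements. The comparison of the coproducts can be made on generators, because both are
multiplicative. -/
theorem exists_model (h : D.IsPrimitivelyGenerated K) :
    ∃ e : Model (SymmetricAlgebra ℝ ({c // K.Conn c} →₀ ℝ)) D,
      ∀ c, e.f (SymmetricAlgebra.ι ℝ _ (gr c)) = gr c.1 := by
  obtain ⟨f', h1, hmul, hX⟩ := K.exists_polyEquiv h.triangular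
  let g := SymmetricAlgebra.equivMvPolynomial
    (Finsupp.basisSingleOne (R := ℝ) (ι := {c // K.Conn c}))
  let f := g.toLinearEquiv.trans f'
  replace h1 : f 1 = gr 0 := (congrArg f' (map_one g)).trans h1
  replace hmul : ∀ p q, f (p * q) = D.mul (f p) (f q) := fun p q =>
    (congrArg f' (map_mul g p q)).trans (hmul _ _)
  replace hX : ∀ c, f (SymmetricAlgebra.ι ℝ _ (gr c)) = gr c.1 := fun c => by
    have : g (SymmetricAlgebra.ι ℝ _ (gr c)) = MvPolynomial.X c := by
      rw [← SymmetricAlgebra.equivMvPolynomial_ι_apply Finsupp.basisSingleOne c,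
        Finsupp.coe_basisSingleOne]
    exact (congrArg f' this).trans (hX c)
  rw [← h.one_eq] at h1
  refine ⟨⟨f, h1, hmul, fun p => ?_, fun p => ?_⟩, hX⟩
  · induction p using SymmetricAlgebra.induction with
    | algebraMap r =>
      rw [Algebra.algebraMap_eq_smul_one]
      simp only [map_smul, h1, h.comul_one, Bialgebra.comul_one, Algebra.TensorProduct.one_def,
        TensorProduct.map_tmul, LinearEquiv.coe_coe]
    | add p q hp hq => simp only [map_add, hp, hq]
    | mul p q hp hq => rw [hmul, h.comul_mul, hp, hq, Bialgebra.comul_mul,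
        TensorProduct.map_mul_of_map_mul f.toLinearMap D.mul hmul]
    | ι x =>
      induction x using Finsupp.induction_linear with
      | zero => simp
      | add x y hx hy => simp only [map_add, hx, hy]
      | single c r =>
        rw [← Finsupp.smul_single_one]
        simp only [map_smul, hX, h.comul_conn _ c.2, SymmetricAlgebra.comul_ι, map_add,
          TensorProduct.map_tmul, LinearEquiv.coe_coe, h1, h.one_eq]
  · induction p using SymmetricAlgebra.induction with
    | algebraMap r =>
      rw [Algebra.algebraMap_eq_smul_one]
      simp only [map_smul, h1, h.counit_one, Bialgebra.counit_one]
    | add p q hp hq => simp only [map_add, hp, hq]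
    | mul p q hp hq => rw [hmul, h.counit_mul, hp, hq, Bialgebra.counit_mul]
    | ι x =>
      induction x using Finsupp.induction_linear with
      | zero => simp
      | add x y hx hy => simp only [map_add, hx, hy]
      | single c r =>
        rw [← Finsupp.smul_single_one]
        simp only [map_smul, hX, h.counit_conn _ c.2, SymmetricAlgebra.counit_ι]

end IsPrimitivelyGenerated

end HopfData

/-- Homomorphisms of bialgebras between Hopf algebras respect the antipodes: both sides are
convolution inverses of the homomorphism. -/
theorem BialgHom.map_antipode {A B : Type} [CommRing A] [CommRing B] [HopfAlgebra ℝ A]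
    [HopfAlgebra ℝ B] (F : A →ₐc[ℝ] B) (x : A) :
    F (HopfAlgebra.antipode ℝ x) = HopfAlgebra.antipode ℝ (F x) := by
  let S := HopfAlgebra.antipode ℝ (A := A)
  let T := HopfAlgebra.antipode ℝ (A := B)
  let φ : A →ₗ[ℝ] B := (F : A →ₐ[ℝ] B).toLinearMap
  have hφ : ∀ x, F x = φ x := fun _ => rfl
  have key : WithConv.toConv (φ ∘ₗ S) = WithConv.toConv (T ∘ₗ φ) := by
    refine left_inv_eq_right_inv (a := WithConv.toConv φ) ?_ ?_
    · ext x
      have h := congrArg F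
        (HopfAlgebra.sum_antipode_mul_eq_algebraMap_counit (Coalgebra.Repr.arbitrary ℝ x))
      rw [(Coalgebra.Repr.arbitrary ℝ x).convMul_apply]
      simp only [map_sum, map_mul] at h
      exact h.trans (AlgHomClass.commutes F _)
    · ext x
      have h := HopfAlgebra.sum_mul_antipode_eq_algebraMap_counit
        ((Coalgebra.Repr.arbitrary ℝ x).induced F)
      rw [(Coalgebra.Repr.arbitrary ℝ x).convMul_apply]
      refine h.trans ?_
      simp
  exact LinearMap.congr_fun (congrArg WithConv.ofConv key) x

/-- Two primitively generated structures `D` and `D'` on the free vector space on `X` are isomorphic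
as Hopf algebras, by the map which fixes the indecomposable elements. -/
theorem HopfData.IsPrimitivelyGenerated.exists_bialgEquiv {X : Type} [AddCommMonoid X]
    {K : Decomposition X} {D D' : HopfData (X →₀ ℝ)} (h : D.IsPrimitivelyGenerated K)
    (h' : D'.IsPrimitivelyGenerated K) :
    ∃ (_ : D.IsHopf) (_ : D'.IsHopf) (Ψ : D.Carrier ≃ₐc[ℝ] D'.Carrier),
      (∀ s : Multiset X, (∀ τ ∈ s, K.Conn τ) → Ψ (s.map fun τ => D.toCarrier (gr τ)).prod =
        (s.map fun τ => D'.toCarrier (gr τ)).prod) ∧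
      (∀ x, Ψ (HopfAlgebra.antipode ℝ x) = HopfAlgebra.antipode ℝ (Ψ x)) ∧
      Function.Bijective (MvPolynomial.aeval (R := ℝ)
        fun τ : {τ : X // K.Conn τ} => D'.toCarrier (gr τ.1)) := by
  obtain ⟨e, he⟩ := h.exists_model
  obtain ⟨e', he'⟩ := h'.exists_model
  have hD := e.isHopf
  have hD' := e'.isHopf
  let E : SymmetricAlgebra ℝ ({c // K.Conn c} →₀ ℝ) ≃ₐ[ℝ] D.Carrier :=
    AlgEquiv.ofLinearEquiv (show _ ≃ₗ[ℝ] D.Carrier from e.f) e.map_one e.map_mul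
  let E' : SymmetricAlgebra ℝ ({c // K.Conn c} →₀ ℝ) ≃ₐ[ℝ] D'.Carrier :=
    AlgEquiv.ofLinearEquiv (show _ ≃ₗ[ℝ] D'.Carrier from e'.f) e'.map_one e'.map_mul
  have hE : ∀ c (hc : K.Conn c), E (SymmetricAlgebra.ι ℝ _ (gr ⟨c, hc⟩)) = D.toCarrier (gr c) :=
    fun c hc => he ⟨c, hc⟩
  have hE' : ∀ c (hc : K.Conn c), E' (SymmetricAlgebra.ι ℝ _ (gr ⟨c, hc⟩)) = D'.toCarrier (gr c) :=
    fun c hc => he' ⟨c, hc⟩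
  let B : SymmetricAlgebra ℝ ({c // K.Conn c} →₀ ℝ) ≃ₐc[ℝ] D.Carrier :=
    BialgEquiv.ofAlgEquiv E (AlgHom.ext e.map_counit) (AlgHom.ext fun p => (e.map_comul p).symm)
  let B' : SymmetricAlgebra ℝ ({c // K.Conn c} →₀ ℝ) ≃ₐc[ℝ] D'.Carrier :=
    BialgEquiv.ofAlgEquiv E' (AlgHom.ext e'.map_counit) (AlgHom.ext fun p => (e'.map_comul p).symm)
  refine ⟨hD, hD', B.symm.trans B', fun s hs => ?_, fun x => ?_, ?_⟩
  · rw [map_multiset_prod, Multiset.map_map]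
    refine congrArg _ (Multiset.map_congr rfl fun τ hτ => ?_)
    change E' (E.symm (D.toCarrier (gr τ))) = _
    rw [← hE τ (hs τ hτ), E.symm_apply_apply, hE']
  · exact BialgHom.map_antipode (B.symm.trans B' : D.Carrier →ₐc[ℝ] D'.Carrier) x
  · let g := SymmetricAlgebra.equivMvPolynomial
      (Finsupp.basisSingleOne (R := ℝ) (ι := {c // K.Conn c}))
    have : MvPolynomial.aeval (R := ℝ) (fun τ : {τ : X // K.Conn τ} => D'.toCarrier (gr τ.1)) =
        (g.symm.trans E' : MvPolynomial {c // K.Conn c} ℝ →ₐ[ℝ] D'.Carrier) := by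
      refine MvPolynomial.algHom_ext fun c => ?_
      rw [MvPolynomial.aeval_X]
      change _ = E' (g.symm (MvPolynomial.X c))
      rw [SymmetricAlgebra.equivMvPolynomial_symm_X, Finsupp.coe_basisSingleOne, hE' c.1 c.2]
    rw [this]
    exact (g.symm.trans E').bijective

/-! ### Dualizing a coproduct -/

section Dual

variable {X : Type}

/-- The bilinear form on the free vector space on `X` for which `X` is orthonormal, as a map to the
dual space. -/
def innerForm (x : X →₀ ℝ) : (X →₀ ℝ) →ₗ[ℝ] ℝ := linExt fun σ => x σ

theorem innerForm_gr (x : X →₀ ℝ) (γ : X) : innerForm x (gr γ) = x γ := by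
  simp [innerForm]

theorem innerForm_comm (x y : X →₀ ℝ) : innerForm x y = innerForm y x := by
  simp only [innerForm, Finsupp.linearCombination_apply, Finsupp.sum, smul_eq_mul]
  classical
  rw [Finset.sum_subset (Finset.subset_union_left (s₂ := x.support)),
    Finset.sum_subset (Finset.subset_union_right (s₁ := y.support) (s₂ := x.support))]
  · exact Finset.sum_congr rfl fun γ _ => mul_comm _ _
  · intro γ _ h
    rw [Finsupp.notMem_support_iff.1 h, zero_mul]
  · intro γ _ h
    rw [Finsupp.notMem_support_iff.1 h, zero_mul]

theorem innerForm_injective : Function.Injective (innerForm (X := X)) := fun x y h => by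
  ext γ
  rw [← innerForm_gr, h, innerForm_gr]

theorem innerForm_add (x y : X →₀ ℝ) : innerForm (x + y) = innerForm x + innerForm y := by
  ext γ
  simp [innerForm]

theorem innerForm_smul (r : ℝ) (x : X →₀ ℝ) : innerForm (r • x) = r • innerForm x := by
  ext γ
  simp [innerForm]

/-- The bilinear form on the tensor square for which the tensors `σ ⊗ τ` are orthonormal,
evaluated at `x ⊗ y` in its first argument. -/
def innerForm₂ (x y : X →₀ ℝ) : (X →₀ ℝ) ⊗[ℝ] (X →₀ ℝ) →ₗ[ℝ] ℝ :=
  LinearMap.mul' ℝ ℝ ∘ₗ TensorProduct.map (innerForm x) (innerForm y)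

@[simp]
theorem innerForm₂_tmul (x y a b : X →₀ ℝ) :
    innerForm₂ x y (a ⊗ₜ b) = innerForm x a * innerForm y b := rfl

theorem pairing_eq_innerForm₂ (σ τ : X) (u : (X →₀ ℝ) ⊗[ℝ] (X →₀ ℝ)) :
    pairing σ τ u = innerForm₂ (gr σ) (gr τ) u := by
  classical
  have : (Finsupp.lapply (σ, τ) ∘ₗ (finsuppTensorFinsupp' ℝ X X).toLinearMap) =
      innerForm₂ (gr σ) (gr τ) := by
    ext a b
    simp only [innerForm, Finsupp.single_apply, innerForm₂]
    simp [Finsupp.single_apply, eq_comm, ← ite_and, and_comm]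
  exact LinearMap.congr_fun this u

theorem eq_of_pairing {u v : (X →₀ ℝ) ⊗[ℝ] (X →₀ ℝ)} (h : ∀ σ τ, pairing σ τ u = pairing σ τ v) :
    u = v := by
  apply (finsuppTensorFinsupp' ℝ X X).injective
  ext ⟨σ, τ⟩
  exact h σ τ

variable [AddCommMonoid X]

@[elab_as_elim]
theorem free_tensor_induction {p : (X →₀ ℝ) ⊗[ℝ] (X →₀ ℝ) → Prop} (w : (X →₀ ℝ) ⊗[ℝ] (X →₀ ℝ))
    (gr : ∀ a b, p (gr a ⊗ₜ gr b)) (add : ∀ x y, p x → p y → p (x + y))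
    (smul : ∀ (r : ℝ) x, p x → p (r • x)) : p w := by
  have h0 : p 0 := by simpa using smul 0 _ (gr 0 0)
  induction w using TensorProduct.induction_on with
  | zero => exact h0
  | add x y hx hy => exact add x y hx hy
  | tmul x y =>
    induction x using free_induction with
    | add x x' hx hx' => rw [TensorProduct.add_tmul]; exact add _ _ hx hx'
    | smul r x hx => rw [← TensorProduct.smul_tmul']; exact smul _ _ hx
    | gr a =>
    induction y using free_induction with
    | add x x' hx hx' => rw [TensorProduct.tmul_add]; exact add _ _ hx hx'
    | smul r x hx => rw [TensorProduct.tmul_smul]; exact smul _ _ hx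
    | gr b => exact gr a b

/-- The adjointness between a coproduct and its dual product. -/
theorem innerForm_dualProduct {D : X → (X →₀ ℝ) ⊗[ℝ] (X →₀ ℝ)} (hD : Dualizable D)
    (x y : X →₀ ℝ) : innerForm (dualProduct D hD x y) = innerForm₂ x y ∘ₗ linExt D := by
  induction x using free_induction with
  | add x x' hx hx' =>
    rw [map_add, LinearMap.add_apply, innerForm_add, hx, hx']
    simp only [innerForm₂, innerForm_add, TensorProduct.map_add_left, LinearMap.comp_add,
      LinearMap.add_comp]
  | smul r x hx =>
    rw [map_smul, LinearMap.smul_apply, innerForm_smul, hx]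
    simp only [innerForm₂, innerForm_smul, TensorProduct.map_smul_left, LinearMap.comp_smul,
      LinearMap.smul_comp]
  | gr σ =>
  induction y using free_induction with
  | add x x' hx hx' =>
    rw [map_add, innerForm_add, hx, hx']
    simp only [innerForm₂, innerForm_add, TensorProduct.map_add_right, LinearMap.comp_add,
      LinearMap.add_comp]
  | smul r x hx =>
    rw [map_smul, innerForm_smul, hx]
    simp only [innerForm₂, innerForm_smul, TensorProduct.map_smul_right, LinearMap.comp_smul,
      LinearMap.smul_comp]
  | gr τ =>
  ext γ
  simp only [LinearMap.comp_apply, Finsupp.lsingle_apply]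
  rw [innerForm_gr, dualProduct_gr_apply, pairing_eq_innerForm₂]
  simp

theorem counitMap_eq_innerForm : (counitMap : (X →₀ ℝ) →ₗ[ℝ] ℝ) = innerForm (gr 0) := by
  classical
  ext γ
  simp [counitMap, innerForm, Finsupp.single_apply, eq_comm]

variable [Finset.HasAntidiagonal X]

/-- The coproduct `Δ_⊔` is adjoint to the product `⊔`. -/
theorem pairing_coDisj (σ τ : X) (x : X →₀ ℝ) : pairing σ τ (linExt coDisj x) = x (σ + τ) := by
  classical
  induction x using free_induction with
  | add x y hx hy =>
    simp only [pairing_eq_innerForm₂, map_add, Finsupp.add_apply] at hx hy ⊢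
    rw [hx, hy]
  | smul r x hx =>
    simp only [pairing_eq_innerForm₂, map_smul, Finsupp.smul_apply] at hx ⊢
    rw [hx]
  | gr γ =>
  have h : pairing σ τ (linExt coDisj (gr γ)) =
      ∑ p ∈ Finset.HasAntidiagonal.antidiagonal γ, if p = (σ, τ) then 1 else 0 := by
    simp only [pairing_eq_innerForm₂, Finsupp.linearCombination_single, one_smul, coDisj, map_sum]
    refine Finset.sum_congr rfl fun p _ => ?_
    rw [← pairing_eq_innerForm₂, pairing_gr_tmul_gr]
    simp only [Prod.ext_iff]
  rw [h, Finset.sum_ite_eq', Finsupp.single_apply]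
  simp only [Finset.HasAntidiagonal.mem_antidiagonal, eq_comm]

/-- The coefficients of a product in the tensor square of `(ℝ⟨X⟩, ⊔)`. -/
theorem pairing_map₂_disjProduct (σ τ : X) (u v : (X →₀ ℝ) ⊗[ℝ] (X →₀ ℝ)) :
    pairing σ τ (TensorProduct.map₂ disjProduct disjProduct u v) =
      ∑ p ∈ Finset.HasAntidiagonal.antidiagonal σ, ∑ q ∈ Finset.HasAntidiagonal.antidiagonal τ,
        pairing p.1 q.1 u * pairing p.2 q.2 v := by
  classical
  simp only [pairing_eq_innerForm₂]
  induction u using free_tensor_induction with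
  | add x y hx hy =>
    simp only [map_add, LinearMap.add_apply, hx, hy, add_mul, Finset.sum_add_distrib]
  | smul r x hx =>
    simp only [map_smul, LinearMap.smul_apply, hx, Finset.mul_sum, smul_eq_mul, mul_assoc]
  | gr a b =>
  induction v using free_tensor_induction with
  | add x y hx hy => simp only [map_add, hx, hy, mul_add, Finset.sum_add_distrib]
  | smul r x hx => simp only [map_smul, hx, Finset.mul_sum, smul_eq_mul, mul_left_comm]
  | gr c d =>
  have hprod : TensorProduct.map₂ disjProduct disjProduct (gr a ⊗ₜ[ℝ] gr b) (gr c ⊗ₜ[ℝ] gr d) =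
      gr (a + c) ⊗ₜ[ℝ] gr (b + d) := by
    simp [disjProduct]
  simp only [← pairing_eq_innerForm₂, hprod, pairing_gr_tmul_gr]
  have hterm : ∀ p q : X × X, ((if a = p.1 ∧ b = q.1 then 1 else 0) *
      (if c = p.2 ∧ d = q.2 then 1 else 0) : ℝ) =
      if q = (b, d) then (if p = (a, c) then 1 else 0) else 0 := by
    rintro ⟨p, p'⟩ ⟨q, q'⟩
    rw [ite_zero_mul_ite_zero, ← ite_and, mul_one]
    refine if_congr ?_ rfl rfl
    simp only [Prod.mk.injEq]
    constructor
    · rintro ⟨⟨rfl, rfl⟩, rfl, rfl⟩; simp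
    · rintro ⟨⟨rfl, rfl⟩, rfl, rfl⟩; simp
  simp only [hterm, Finset.sum_ite_eq', Finset.HasAntidiagonal.mem_antidiagonal]
  by_cases h : b + d = τ <;> simp [h, Finset.HasAntidiagonal.mem_antidiagonal]

/-- A coproduct on the free vector space on `X`, given on basis vectors, which is coassociative,
cocommutative, counital, multiplicative for `⊔`, and triangular: `σ ⊗ τ` occurs in the coproduct of
`σ ⊔ τ`, and apart from that only in coproducts of elements of smaller rank. -/
structure IsGoodCoproduct (K : Decomposition X) (D : X → (X →₀ ℝ) ⊗[ℝ] (X →₀ ℝ)) : Prop where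
  coassoc : TensorProduct.assoc ℝ (X →₀ ℝ) (X →₀ ℝ) (X →₀ ℝ) ∘ₗ (linExt D).rTensor _ ∘ₗ linExt D =
    (linExt D).lTensor _ ∘ₗ linExt D
  cocomm : ∀ x, TensorProduct.comm ℝ _ _ (linExt D x) = linExt D x
  counit_left : ∀ x, counitMap.rTensor _ (linExt D x) = 1 ⊗ₜ[ℝ] x
  coprod_zero : D 0 = gr 0 ⊗ₜ[ℝ] gr 0
  coprod_add : ∀ σ τ, D (σ + τ) = TensorProduct.map₂ disjProduct disjProduct (D σ) (D τ)
  eq_or_lt : ∀ σ τ γ, pairing σ τ (D γ) ≠ 0 → γ = σ + τ ∨ K.rank γ < K.rank σ + K.rank τ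
  ne_zero : ∀ σ τ, pairing σ τ (D (σ + τ)) ≠ 0

/-- A triangular product which is compatible with `Δ_⊔` and with the counit. -/
structure IsGoodProduct (K : Decomposition X) (m : BilinProduct X) : Prop where
  triangular : IsTriangularProduct K.rank m
  comul_mul : ∀ x y, linExt coDisj (m x y) =
    TensorProduct.map₂ m m (linExt coDisj x) (linExt coDisj y)
  counit_mul : ∀ x y, counitMap (m x y) = counitMap x * counitMap y

/-- Each property of the dual product is adjoint to a property of the coproduct: associativity to
coassociativity, commutativity to cocommutativity, the unit to the counit, and compatibility with
`Δ_⊔` to multiplicativity for `⊔`. -/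
theorem IsGoodCoproduct.isGoodProduct {K : Decomposition X} {D : X → (X →₀ ℝ) ⊗[ℝ] (X →₀ ℝ)}
    (h : IsGoodCoproduct K D) (hD : Dualizable D) : IsGoodProduct K (dualProduct D hD) where
  triangular :=
    { assoc x y z := by
        apply innerForm_injective
        rw [innerForm_dualProduct, innerForm_dualProduct]
        have h1 : innerForm₂ (dualProduct D hD x y) z = LinearMap.mul' ℝ ℝ ∘ₗ
            TensorProduct.map (innerForm₂ x y) (innerForm z) ∘ₗ (linExt D).rTensor _ := by
          rw [innerForm₂, innerForm_dualProduct, LinearMap.map_comp_rTensor]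
        have h2 : innerForm₂ x (dualProduct D hD y z) = LinearMap.mul' ℝ ℝ ∘ₗ
            TensorProduct.map (innerForm x) (innerForm₂ y z) ∘ₗ (linExt D).lTensor _ := by
          rw [innerForm₂, innerForm_dualProduct, LinearMap.map_comp_lTensor]
        have h3 : LinearMap.mul' ℝ ℝ ∘ₗ TensorProduct.map (innerForm₂ x y) (innerForm z) =
            (LinearMap.mul' ℝ ℝ ∘ₗ TensorProduct.map (innerForm x) (innerForm₂ y z)) ∘ₗ
              (TensorProduct.assoc ℝ _ _ _).toLinearMap := by
          refine TensorProduct.ext_threefold fun a b c => ?_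
          simp [mul_assoc]
        rw [h1, h2, ← LinearMap.comp_assoc, h3, LinearMap.comp_assoc, LinearMap.comp_assoc,
          LinearMap.comp_assoc, LinearMap.comp_assoc]
        exact congrArg _ (congrArg _ h.coassoc)
      comm x y := by
        apply innerForm_injective
        rw [innerForm_dualProduct, innerForm_dualProduct]
        refine LinearMap.ext fun z => ?_
        rw [LinearMap.comp_apply, LinearMap.comp_apply]
        have h3 : innerForm₂ x y ∘ₗ (TensorProduct.comm ℝ _ _).toLinearMap = innerForm₂ y x := by
          refine TensorProduct.ext' fun a b => ?_
          simp [mul_comm]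
        exact (congrArg _ (h.cocomm z)).symm.trans (LinearMap.congr_fun h3 _)
      one_mul x := by
        apply innerForm_injective
        rw [innerForm_dualProduct]
        refine LinearMap.ext fun z => ?_
        have h3 : innerForm₂ (gr 0) x = LinearMap.mul' ℝ ℝ ∘ₗ
            TensorProduct.map LinearMap.id (innerForm x) ∘ₗ counitMap.rTensor _ := by
          rw [LinearMap.map_comp_rTensor, LinearMap.id_comp, counitMap_eq_innerForm, innerForm₂]
        rw [LinearMap.comp_apply, h3, LinearMap.comp_apply, LinearMap.comp_apply, h.counit_left]
        simp
      eq_or_lt σ τ γ hγ := h.eq_or_lt σ τ γ (by rwa [dualProduct_gr_apply] at hγ)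
      ne_zero σ τ := by rw [dualProduct_gr_apply]; exact h.ne_zero σ τ }
  comul_mul x y := by
    induction x using free_induction with
    | add x y hx hy => simp only [map_add, LinearMap.add_apply, hx, hy]
    | smul r x hx => simp only [map_smul, LinearMap.smul_apply, hx]
    | gr σ =>
    induction y using free_induction with
    | add x y hx hy => simp only [map_add, hx, hy]
    | smul r x hx => simp only [map_smul, hx]
    | gr τ =>
    refine eq_of_pairing fun α β => ?_
    rw [pairing_coDisj, dualProduct_gr_apply, h.coprod_add, pairing_map₂_disjProduct]
    simp only [Finsupp.linearCombination_single, one_smul, coDisj, map_sum, LinearMap.sum_apply,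
      pairing_eq_innerForm₂, TensorProduct.map₂_apply_tmul]
    rw [Finset.sum_comm]
    refine Finset.sum_congr rfl fun q _ => Finset.sum_congr rfl fun p _ => ?_
    rw [TensorProduct.map_tmul, innerForm₂_tmul, ← pairing_eq_innerForm₂, ← pairing_eq_innerForm₂,
      ← dualProduct_gr_apply hD, ← dualProduct_gr_apply hD]
    rw [innerForm_comm, innerForm_gr, innerForm_comm, innerForm_gr]
  counit_mul x y := by
    rw [counitMap_eq_innerForm]
    rw [innerForm_comm, innerForm_dualProduct, LinearMap.comp_apply,
      Finsupp.linearCombination_single, one_smul, h.coprod_zero, innerForm₂_tmul, innerForm_comm x,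
      innerForm_comm y]

end Dual

/-! ### The two Hopf algebras and the isomorphism between them -/

section Abstract

variable {X : Type} [AddCommMonoid X] (K : Decomposition X)

theorem counitMap_gr_of_conn {c : X} (hc : K.Conn c) : counitMap (gr c) = 0 := by
  have hne : c ≠ 0 := by
    rintro rfl
    have := K.rank_conn hc
    rw [Decomposition.rank, K.comp_zero] at this
    simp at this
  simp [counitMap, hne]

/-- The structure maps `(⊔, Δ_DP)` are primitively generated. -/
theorem isPrimitivelyGenerated_symHopf :
    (symHopf fun τ => coDPProd (K.comp τ)).IsPrimitivelyGenerated K where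
  triangular := isTriangularProduct_disjProduct _
  one_eq := rfl
  comul_one := by simp [K.comp_zero, coDPProd_zero]
  comul_mul x y := by
    induction x using free_induction with
    | add x y hx hy => simp only [map_add, LinearMap.add_apply, hx, hy]
    | smul r x hx => simp only [map_smul, LinearMap.smul_apply, hx]
    | gr σ =>
    induction y using free_induction with
    | add x y hx hy => simp only [map_add, hx, hy]
    | smul r x hx => simp only [map_smul, hx]
    | gr τ => simp only [disjProduct, bilinExt_gr, Finsupp.linearCombination_single, one_smul,
        K.comp_add, coDPProd_add]
  counit_one := by simp [counitMap]
  counit_mul x y := by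
    induction x using free_induction with
    | add x y hx hy => simp only [map_add, LinearMap.add_apply, hx, hy, add_mul]
    | smul r x hx => simp only [map_smul, LinearMap.smul_apply, hx, smul_eq_mul, mul_assoc]
    | gr σ =>
    induction y using free_induction with
    | add x y hx hy => simp only [map_add, hx, hy, mul_add]
    | smul r x hx => simp only [map_smul, hx, smul_eq_mul, mul_left_comm]
    | gr τ =>
    classical
    have h : σ + τ = 0 ↔ σ = 0 ∧ τ = 0 := by
      refine ⟨fun h => ?_, fun ⟨h, h'⟩ => by simp [h, h']⟩
      have h' := K.rank_add σ τ
      rw [h, Decomposition.rank, K.comp_zero, Multiset.card_zero] at h'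
      exact ⟨K.eq_zero_of_rank (by omega), K.eq_zero_of_rank (by omega)⟩
    simp [counitMap, disjProduct, Finsupp.single_apply, h, ← ite_and, and_comm]
  comul_conn c hc := by
    simp [K.comp_conn c hc, coDPProd_singleton]
  counit_conn c hc := counitMap_gr_of_conn K hc

/-- Coassociativity and cocommutativity of `Δ_DP` are inherited from the symmetric algebra. For
triangularity, `Δ_DP(γ)` is the sum of `σ ⊗ τ` over the splittings of the components of `γ` into two
multisets. -/
theorem isGoodCoproduct_coDPProd : IsGoodCoproduct K fun τ => coDPProd (K.comp τ) := by
  have h := isPrimitivelyGenerated_symHopf K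
  obtain ⟨e, -⟩ := h.exists_model
  have hH := e.isHopf
  exact
  { coassoc := hH.coassoc
    cocomm := e.comm_comul
    counit_left := hH.counit_left
    coprod_zero := by rw [K.comp_zero, coDPProd_zero]
    coprod_add σ τ := by rw [K.comp_add, coDPProd_add]
    eq_or_lt σ τ γ hγ := Or.inl (by rw [exists_of_pairing_coDPProd hγ, K.comp_sum])
    ne_zero σ τ := by
      classical
      have hs : pairing σ τ (coDPProd (K.comp (σ + τ))) = ((K.comp (σ + τ)).antidiagonal.map
          fun p => pairing σ τ (gr p.1.sum ⊗ₜ[ℝ] gr p.2.sum)).sum := by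
        rw [coDPProd_eq]
        simp only [pairing_eq_innerForm₂]
        rw [← Multiset.sum_hom, Multiset.map_map]
        rfl
      rw [hs]
      refine ne_of_gt (lt_of_lt_of_le one_pos (Multiset.single_le_sum ?_ 1 ?_))
      · intro x hx
        obtain ⟨p, -, rfl⟩ := Multiset.mem_map.1 hx
        rw [pairing_gr_tmul_gr]
        split_ifs <;> simp
      · refine Multiset.mem_map.2 ⟨(K.comp σ, K.comp τ), ?_, ?_⟩
        · rw [Multiset.mem_antidiagonal, K.comp_add]
        · rw [pairing_gr_tmul_gr, K.comp_sum, K.comp_sum, if_pos ⟨rfl, rfl⟩] }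

/-- In the Hopf algebra with product `⊔`, a product of basis vectors is the basis vector of the
sum. -/
theorem toCarrier_gr_multiset_sum {Δ : X → (X →₀ ℝ) ⊗[ℝ] (X →₀ ℝ)} [(symHopf Δ).IsHopf]
    (s : Multiset X) : (symHopf Δ).toCarrier (gr s.sum) =
      (s.map fun τ => (symHopf Δ).toCarrier (gr τ)).prod := by
  induction s using Multiset.induction with
  | empty => rfl
  | cons a s ih =>
    rw [Multiset.map_cons, Multiset.prod_cons, ← ih, Multiset.sum_cons]
    exact (bilinExt_gr (fun σ τ : X => gr (σ + τ)) a s.sum).symm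

variable [Finset.HasAntidiagonal X]

/-- Indecomposable elements are primitive for `Δ_⊔`. -/
theorem coDisj_of_conn {c : X} (hc : K.Conn c) :
    coDisj c = gr c ⊗ₜ[ℝ] gr 0 + gr 0 ⊗ₜ[ℝ] gr c := by
  classical
  have hne : c ≠ 0 := by
    rintro rfl
    have := K.rank_conn hc
    rw [Decomposition.rank, K.comp_zero] at this
    simp at this
  have : Finset.HasAntidiagonal.antidiagonal c = {(c, 0), (0, c)} := by
    ext ⟨a, b⟩
    simp only [Finset.HasAntidiagonal.mem_antidiagonal, Finset.mem_insert, Finset.mem_singleton,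
      Prod.mk.injEq]
    constructor
    · rintro rfl
      have h := K.rank_conn hc
      rw [K.rank_add] at h
      rcases Nat.eq_zero_or_pos (K.rank a) with ha | ha
      · right
        simp [K.eq_zero_of_rank ha]
      · left
        simp [K.eq_zero_of_rank (τ := b) (by omega)]
    · rintro (⟨rfl, rfl⟩ | ⟨rfl, rfl⟩) <;> simp
  rw [coDisj, this, Finset.sum_pair (by simp [hne])]

variable {K}

/-- The structure maps `(m, Δ_⊔)` of a good product are primitively generated. -/
theorem IsGoodProduct.isPrimitivelyGenerated {m : BilinProduct X} (h : IsGoodProduct K m) :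
    (dualHopf m).IsPrimitivelyGenerated K where
  triangular := h.triangular
  one_eq := rfl
  comul_one := by
    classical
    refine eq_of_pairing fun σ τ => ?_
    rw [pairing_coDisj, pairing_gr_tmul_gr, Finsupp.single_apply]
    refine if_congr ⟨fun h => ?_, fun ⟨h, h'⟩ => by simp [← h, ← h']⟩ rfl rfl
    have h' := K.rank_add σ τ
    rw [← h, Decomposition.rank, K.comp_zero, Multiset.card_zero] at h'
    rw [K.eq_zero_of_rank (τ := σ) (by omega), K.eq_zero_of_rank (τ := τ) (by omega)]
    exact ⟨rfl, rfl⟩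
  comul_mul := h.comul_mul
  counit_one := by simp [counitMap]
  counit_mul := h.counit_mul
  comul_conn c hc := by simp [coDisj_of_conn K hc]
  counit_conn c hc := counitMap_gr_of_conn K hc

theorem IsGoodProduct.exists_bialgEquiv {m : BilinProduct X} (h : IsGoodProduct K m) :
    ∃ (_ : (symHopf fun τ => coDPProd (K.comp τ)).IsHopf) (_ : (dualHopf m).IsHopf)
      (Ψ : (symHopf fun τ => coDPProd (K.comp τ)).Carrier ≃ₐc[ℝ] (dualHopf m).Carrier),
      (∀ s : Multiset X, (∀ τ ∈ s, K.Conn τ) →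
        Ψ ((symHopf fun τ => coDPProd (K.comp τ)).toCarrier (gr s.sum)) =
          (s.map fun τ => (dualHopf m).toCarrier (gr τ)).prod) ∧
      (∀ x, Ψ (HopfAlgebra.antipode ℝ x) = HopfAlgebra.antipode ℝ (Ψ x)) ∧
      Function.Bijective (MvPolynomial.aeval (R := ℝ)
        fun τ : {τ : X // K.Conn τ} => (dualHopf m).toCarrier (gr τ.1)) := by
  obtain ⟨h1, h2, Ψ, h3, h4, h5⟩ :=
    (isPrimitivelyGenerated_symHopf K).exists_bialgEquiv h.isPrimitivelyGenerated
  exact ⟨h1, h2, Ψ, fun s hs => by rw [toCarrier_gr_multiset_sum, h3 s hs], h4, h5⟩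

/-- A good product restricts to a good product along an injective morphism of commutative monoids
whose image is closed under summands, provided that the rank is preserved. -/
theorem IsGoodProduct.restrict {Y : Type} [AddCommMonoid Y] [Finset.HasAntidiagonal Y]
    {L : Decomposition Y} {m : BilinProduct X} (h : IsGoodProduct K m) {m' : BilinProduct Y}
    (ι : Y →+ X) (hι : Function.Injective ι)
    (hsum : ∀ a b c, a + b = ι c → ∃ a' b', ι a' = a ∧ ι b' = b)
    (hrank : ∀ τ, L.rank τ = K.rank (ι τ))
    (hm : ∀ x y, Finsupp.lmapDomain ℝ ℝ ι (m' x y) =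
      m (Finsupp.lmapDomain ℝ ℝ ι x) (Finsupp.lmapDomain ℝ ℝ ι y)) : IsGoodProduct L m' := by
  set f := Finsupp.lmapDomain ℝ ℝ ι with hf
  have hinj : Function.Injective f := Finsupp.mapDomain_injective hι
  have hgr : ∀ τ, f (gr τ) = gr (ι τ) := fun τ => by simp [hf, Finsupp.mapDomain_single]
  have happ : ∀ x τ, f x (ι τ) = x τ := fun x τ => Finsupp.mapDomain_apply hι x τ
  have hcounit : ∀ x, counitMap (f x) = counitMap x := fun x => by
    have := happ x 0
    rwa [map_zero] at this
  have hcoeff : ∀ σ τ γ, m' (gr σ) (gr τ) γ = m (gr (ι σ)) (gr (ι τ)) (ι γ) := fun σ τ γ => by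
    rw [← happ, hm, hgr, hgr]
  have hcomul : ∀ x, TensorProduct.map f f (linExt coDisj x) = linExt coDisj (f x) := fun x => by
    induction x using free_induction with
    | add x y hx hy => simp only [map_add, hx, hy]
    | smul r x hx => simp only [map_smul, hx]
    | gr γ =>
    rw [hgr]
    simp only [Finsupp.linearCombination_single, one_smul, coDisj, map_sum, TensorProduct.map_tmul,
      hgr]
    refine Finset.sum_nbij (fun p => (ι p.1, ι p.2)) (fun p hp => ?_) (fun p _ q _ hpq => ?_)
      (fun p hp => ?_) fun p _ => rfl
    · rw [Finset.HasAntidiagonal.mem_antidiagonal] at hp ⊢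
      rw [← map_add, hp]
    · exact Prod.ext (hι (congrArg Prod.fst hpq)) (hι (congrArg Prod.snd hpq))
    · rw [Finset.mem_coe, Finset.HasAntidiagonal.mem_antidiagonal] at hp
      obtain ⟨a, b, ha, hb⟩ := hsum _ _ _ hp
      refine ⟨(a, b), ?_, Prod.ext ha hb⟩
      rw [Finset.mem_coe, Finset.HasAntidiagonal.mem_antidiagonal]
      exact hι (by rw [map_add, ha, hb, hp])
  have hinj₂ : Function.Injective (TensorProduct.map f f) :=
    TensorProduct.map_injective_of_flat_flat _ _ hinj hinj
  have hmap₂ : ∀ u v, TensorProduct.map f f (TensorProduct.map₂ m' m' u v) =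
      TensorProduct.map₂ m m (TensorProduct.map f f u) (TensorProduct.map f f v) := fun u v => by
    induction u using TensorProduct.induction_on with
    | zero => simp
    | add x y hx hy => simp only [map_add, LinearMap.add_apply, hx, hy]
    | tmul a b =>
      induction v using TensorProduct.induction_on with
      | zero => simp
      | add x y hx hy => simp only [map_add, hx, hy]
      | tmul c d => simp [hm]
  exact
  { triangular :=
      { assoc x y z := hinj (by simp only [hm, h.triangular.assoc])
        comm x y := hinj (by simp only [hm, h.triangular.comm])
        one_mul x := hinj (by rw [hm, hgr, map_zero, h.triangular.one_mul])
        eq_or_lt σ τ γ hγ := by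
          rw [hcoeff] at hγ
          rw [hrank, hrank, hrank, ← hι.eq_iff, map_add]
          exact h.triangular.eq_or_lt _ _ _ hγ
        ne_zero σ τ := by
          rw [hcoeff, map_add]
          exact h.triangular.ne_zero _ _ }
    comul_mul x y := hinj₂ (by rw [hcomul, hm, h.comul_mul, hmap₂, hcomul, hcomul])
    counit_mul x y := by rw [← hcounit, hm, h.counit_mul, hcounit, hcounit] }

end Abstract

/-! ### Coproducts of shuffle and quasi-shuffle type -/

section CoSum

variable {X : Type}

/-- The sets `A` and `B` cover the ground set and, if `q` holds, they are disjoint. -/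
def IsCover (q : Prop) {S : Type} (A B : Set S) : Prop := A ∪ B = Set.univ ∧ (q → Disjoint A B)

open scoped Classical in
/-- The sum of `r(A) ⊗ r(B)` over all pairs `(A, B)` of sets covering `S`, which are required to be
disjoint if `q` holds. -/
def coSum (q : Prop) {S : Type} [Finite S] (r : Set S → X) : (X →₀ ℝ) ⊗[ℝ] (X →₀ ℝ) :=
  letI := Fintype.ofFinite (Set S)
  ∑ A : Set S, ∑ B : Set S, if IsCover q A B then gr (r A) ⊗ₜ[ℝ] gr (r B) else 0

theorem coShuffleSum_eq_coSum {S : Type} [Finite S] (r : Set S → X) :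
    coShuffleSum r = coSum True r := by
  classical
  let := Fintype.ofFinite (Set S)
  refine Finset.sum_congr rfl fun A _ => ?_
  have : ∀ B : Set S, IsCover True A B ↔ B = Aᶜ := fun B => by
    rw [IsCover, true_imp_iff]
    change A ⊔ B = ⊤ ∧ Disjoint A B ↔ _
    rw [← codisjoint_iff, and_comm, ← isCompl_iff]
    exact ⟨fun h => h.compl_eq.symm, fun h => h ▸ isCompl_compl⟩
  simp only [this, Finset.sum_ite_eq', Finset.mem_univ, if_true]

theorem coQuasiShuffleSum_eq_coSum {S : Type} [Finite S] (r : Set S → X) :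
    coQuasiShuffleSum r = coSum False r := by
  classical
  let := Fintype.ofFinite (Set S)
  refine Finset.sum_congr rfl fun A _ => ?_
  rw [Finset.sum_filter]
  refine Finset.sum_congr rfl fun B _ => if_congr ?_ rfl rfl
  rw [IsCover, false_imp_iff, and_true, Set.compl_subset_iff_union]

open scoped Classical in
/-- The sum over the covers of the image of an injection, expressed by subsets of the codomain. -/
theorem coSum_of_injective (q : Prop) {S T : Type} [Finite S] [Finite T] [Fintype (Set S)]
    {j : T → S} (hj : Function.Injective j) (r : Set S → X) :
    coSum q (fun B => r (j '' B)) = ∑ C : Set S, ∑ D : Set S,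
      if C ∪ D = Set.range j ∧ (q → Disjoint C D) then gr (r C) ⊗ₜ[ℝ] gr (r D) else 0 := by
  let := Fintype.ofFinite (Set T)
  have hi : Set.InjOn (fun B : Set T => j '' B) (Finset.univ : Finset (Set T)) :=
    hj.image_injective.injOn
  have hr : ∀ C, C ⊆ Set.range j →
      C ∈ (fun B : Set T => j '' B) '' (Finset.univ : Finset (Set T)) :=
    fun C hC => ⟨j ⁻¹' C, by simp, Set.image_preimage_eq_of_subset hC⟩
  refine Finset.sum_of_injOn (fun B => j '' B) hi (fun _ _ => Finset.mem_coe.2 (Finset.mem_univ _))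
    (fun C _ hC => ?_) fun A _ => ?_
  · refine Finset.sum_eq_zero fun D _ => if_neg fun h => hC (hr C ?_)
    rw [← h.1]
    exact Set.subset_union_left
  · refine Finset.sum_of_injOn (fun B => j '' B) hi
      (fun _ _ => Finset.mem_coe.2 (Finset.mem_univ _)) (fun C _ hC => ?_) fun B _ => if_congr ?_ rfl rfl
    · refine if_neg fun h => hC (hr C ?_)
      rw [← h.1]
      exact Set.subset_union_right
    · rw [IsCover, ← Set.image_union, ← Set.image_univ, hj.image_injective.eq_iff,
        Set.disjoint_image_iff hj]

/-- A coefficient of the coproduct counts covers; in particular it is nonnegative. -/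
theorem pairing_coSum [DecidableEq X] (q : Prop) {S : Type} [Finite S] [Fintype (Set S)]
    (r : Set S → X) (σ τ : X) [∀ A B : Set S, Decidable (IsCover q A B ∧ r A = σ ∧ r B = τ)] :
    pairing σ τ (coSum q r) =
      ∑ A : Set S, ∑ B : Set S, if IsCover q A B ∧ r A = σ ∧ r B = τ then 1 else 0 := by
  classical
  rw [pairing_eq_innerForm₂, coSum]
  simp only [map_sum]
  refine Finset.sum_congr (by ext; simp) fun A _ => Finset.sum_congr (by ext; simp) fun B _ => ?_
  rw [apply_ite (innerForm₂ (gr σ) (gr τ)), map_zero, ← pairing_eq_innerForm₂, pairing_gr_tmul_gr]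
  by_cases h : IsCover q A B <;> simp [h]

end CoSum

/-- A system of restriction maps: every `τ : X` has a finite ground set, and can be restricted to
every subset of it. The axioms say that restricting twice is restricting once, that restriction is
compatible with addition, and that `τ` is the sum of its restrictions to two sets covering the ground
set, or of smaller rank than that sum. -/
structure RestrictionSystem (X : Type) [AddCommMonoid X] (K : Decomposition X) where
  /-- the ground set -/
  S : X → Type
  [finite : ∀ τ, Finite (S τ)]
  /-- the restriction to a subset of the ground set -/
  r : ∀ τ, Set (S τ) → X
  isEmpty_zero : IsEmpty (S 0)
  r_univ : ∀ τ, r τ Set.univ = τ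
  r_empty : ∀ τ, r τ ∅ = 0
  r_r : ∀ τ A, ∃ j : S (r τ A) → S τ, Function.Injective j ∧ Set.range j = A ∧
    ∀ B, r (r τ A) B = r τ (j '' B)
  r_add : ∀ σ τ, ∃ (i : S σ → S (σ + τ)) (j : S τ → S (σ + τ)),
    Function.Bijective (Sum.elim i j) ∧ ∀ A, r (σ + τ) A = r σ (i ⁻¹' A) + r τ (j ⁻¹' A)
  eq_or_lt : ∀ τ A B, A ∪ B = Set.univ →
    τ = r τ A + r τ B ∨ K.rank τ < K.rank (r τ A) + K.rank (r τ B)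

namespace RestrictionSystem

variable {X : Type} [AddCommMonoid X] {K : Decomposition X} (R : RestrictionSystem X K) (q : Prop)

attribute [instance] RestrictionSystem.finite

/-- The coproduct of shuffle type (if `q` holds) or quasi-shuffle type (otherwise) of a system of
restriction maps. -/
def coprod (τ : X) : (X →₀ ℝ) ⊗[ℝ] (X →₀ ℝ) := coSum q (R.r τ)

theorem coprod_zero : R.coprod q 0 = gr 0 ⊗ₜ[ℝ] gr 0 := by
  classical
  let := Fintype.ofFinite (Set (R.S 0))
  have := R.isEmpty_zero
  have hr : ∀ A, R.r 0 A = 0 := fun A => by rw [Set.eq_empty_of_isEmpty A, R.r_empty]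
  rw [coprod, coSum]
  have hc : ∀ A B : Set (R.S 0), IsCover q A B := fun A B =>
    ⟨Set.ext fun x => this.elim x, fun _ => Set.disjoint_left.2 fun x => this.elim x⟩
  simp only [hr, hc, if_true]
  rw [Fintype.sum_unique, Fintype.sum_unique]

/-- Coassociativity holds because both iterated coproducts are sums over covers of the ground set by
three sets, and multiplicativity because a cover of the ground set of `σ ⊔ τ` consists of a cover for
`σ` and one for `τ`. -/
theorem isGoodCoproduct : IsGoodCoproduct K (R.coprod q) where
  coassoc := by
    classical
    ext γ : 2
    let := Fintype.ofFinite (Set (R.S γ))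
    have hr : ∀ A, R.coprod q (R.r γ A) = ∑ C : Set (R.S γ), ∑ D : Set (R.S γ),
        if C ∪ D = A ∧ (q → Disjoint C D) then gr (R.r γ C) ⊗ₜ[ℝ] gr (R.r γ D) else 0 := by
      intro A
      obtain ⟨j, hj, hA, hr⟩ := R.r_r γ A
      rw [coprod, funext hr, coSum_of_injective q hj, hA]
    have hD : ∀ τ, linExt (R.coprod q) (gr τ) = R.coprod q τ := fun τ => by simp
    -- both sides are the sum over all covers of the ground set by three sets
    let T (A B C : Set (R.S γ)) : Prop :=
      A ∪ B ∪ C = Set.univ ∧ (q → Disjoint A B ∧ Disjoint A C ∧ Disjoint B C)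
    let g (A B C : Set (R.S γ)) : (X →₀ ℝ) ⊗[ℝ] ((X →₀ ℝ) ⊗[ℝ] (X →₀ ℝ)) :=
      gr (R.r γ A) ⊗ₜ[ℝ] (gr (R.r γ B) ⊗ₜ[ℝ] gr (R.r γ C))
    have hl : (TensorProduct.assoc ℝ (X →₀ ℝ) (X →₀ ℝ) (X →₀ ℝ))
        ((linExt (R.coprod q)).rTensor _ (R.coprod q γ)) =
          ∑ C : Set (R.S γ), ∑ A : Set (R.S γ), ∑ B : Set (R.S γ),
            if T A B C then g A B C else 0 := by
      have h1 : ∀ A B : Set (R.S γ), (TensorProduct.assoc ℝ (X →₀ ℝ) (X →₀ ℝ) (X →₀ ℝ))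
          ((linExt (R.coprod q)).rTensor _
            (if IsCover q A B then gr (R.r γ A) ⊗ₜ[ℝ] gr (R.r γ B) else 0)) =
          ∑ C : Set (R.S γ), ∑ D : Set (R.S γ),
            if IsCover q A B ∧ C ∪ D = A ∧ (q → Disjoint C D) then g C D B else 0 := by
        intro A B
        by_cases h : IsCover q A B
        · rw [if_pos h, LinearMap.rTensor_tmul, hD, hr]
          simp only [TensorProduct.sum_tmul, map_sum, h, true_and]
          refine Finset.sum_congr rfl fun C _ => Finset.sum_congr rfl fun D _ => ?_
          split_ifs
          · rfl
          · simp
        · simp [h]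
      rw [coprod, coSum]
      simp only [map_sum, h1]
      rw [Finset.sum_comm]
      refine Finset.sum_congr rfl fun B _ => ?_
      rw [Finset.sum_comm]
      refine Finset.sum_congr rfl fun C _ => ?_
      rw [Finset.sum_comm]
      refine Finset.sum_congr rfl fun D _ => ?_
      rw [Finset.sum_eq_single (C ∪ D)]
      · refine if_congr ?_ rfl rfl
        simp only [T, IsCover, Set.disjoint_union_left]
        tauto
      · exact fun A _ hA => if_neg fun h => hA h.2.1.symm
      · simp
    have hrt : (linExt (R.coprod q)).lTensor _ (R.coprod q γ) =
        ∑ A : Set (R.S γ), ∑ B : Set (R.S γ), ∑ C : Set (R.S γ),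
          if T A B C then g A B C else 0 := by
      have h1 : ∀ A B : Set (R.S γ), (linExt (R.coprod q)).lTensor _
            (if IsCover q A B then gr (R.r γ A) ⊗ₜ[ℝ] gr (R.r γ B) else 0) =
          ∑ C : Set (R.S γ), ∑ D : Set (R.S γ),
            if IsCover q A B ∧ C ∪ D = B ∧ (q → Disjoint C D) then g A C D else 0 := by
        intro A B
        by_cases h : IsCover q A B
        · rw [if_pos h, LinearMap.lTensor_tmul, hD, hr]
          simp only [TensorProduct.tmul_sum, h, true_and]
          refine Finset.sum_congr rfl fun C _ => Finset.sum_congr rfl fun D _ => ?_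
          split_ifs
          · rfl
          · simp
        · simp [h]
      rw [coprod, coSum]
      simp only [map_sum, h1]
      refine Finset.sum_congr rfl fun A _ => ?_
      rw [Finset.sum_comm]
      refine Finset.sum_congr rfl fun C _ => ?_
      rw [Finset.sum_comm]
      refine Finset.sum_congr rfl fun D _ => ?_
      rw [Finset.sum_eq_single (C ∪ D)]
      · refine if_congr ?_ rfl rfl
        simp only [T, IsCover, Set.disjoint_union_right, Set.union_assoc]
        tauto
      · exact fun A _ hA => if_neg fun h => hA h.2.1.symm
      · simp
    change (TensorProduct.assoc ℝ (X →₀ ℝ) (X →₀ ℝ) (X →₀ ℝ))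
        ((linExt (R.coprod q)).rTensor _ (linExt (R.coprod q) (gr γ))) =
      (linExt (R.coprod q)).lTensor _ (linExt (R.coprod q) (gr γ))
    rw [hD, hl, hrt, Finset.sum_comm]
    exact Finset.sum_congr rfl fun A _ => Finset.sum_comm
  cocomm x := by
    classical
    induction x using free_induction with
    | add x y hx hy => simp only [map_add, hx, hy]
    | smul r x hx => simp only [map_smul, hx]
    | gr γ =>
    let := Fintype.ofFinite (Set (R.S γ))
    simp only [Finsupp.linearCombination_single, one_smul, coprod, coSum, map_sum]
    rw [Finset.sum_comm]
    refine Finset.sum_congr rfl fun A _ => Finset.sum_congr rfl fun B _ => ?_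
    rw [apply_ite (TensorProduct.comm ℝ (X →₀ ℝ) (X →₀ ℝ)), TensorProduct.comm_tmul, map_zero]
    exact if_congr (by rw [IsCover, IsCover, Set.union_comm, disjoint_comm]) rfl rfl
  counit_left x := by
    classical
    induction x using free_induction with
    | add x y hx hy => simp only [map_add, hx, hy, TensorProduct.tmul_add]
    | smul r x hx => simp only [map_smul, hx, TensorProduct.tmul_smul]
    | gr γ =>
    let := Fintype.ofFinite (Set (R.S γ))
    have h0 : ∀ A, R.r γ A = 0 ↔ A = ∅ := fun A => by
      refine ⟨fun h => ?_, fun h => h ▸ R.r_empty γ⟩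
      obtain ⟨j, -, hA, -⟩ := R.r_r γ A
      have := R.isEmpty_zero
      rw [← h] at this
      rw [← hA, Set.range_eq_empty]
    simp only [Finsupp.linearCombination_single, one_smul, coprod, coSum, map_sum]
    rw [Finset.sum_eq_single ∅, Finset.sum_eq_single Set.univ]
    · have : IsCover q (∅ : Set (R.S γ)) Set.univ :=
        ⟨Set.empty_union _, fun _ => Set.empty_disjoint _⟩
      simp [R.r_univ, R.r_empty, counitMap, this]
    · intro B _ hB
      have : ¬ IsCover q ∅ B := fun h => hB (by rw [← h.1, Set.empty_union])
      simp [this]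
    · simp
    · intro A _ hA
      refine Finset.sum_eq_zero fun B _ => ?_
      rw [apply_ite (LinearMap.rTensor _ _), LinearMap.rTensor_tmul, map_zero]
      simp [counitMap, h0, hA]
    · simp
  coprod_zero := R.coprod_zero q
  coprod_add σ τ := by
    classical
    let := Fintype.ofFinite (Set (R.S σ))
    let := Fintype.ofFinite (Set (R.S τ))
    let := Fintype.ofFinite (Set (R.S (σ + τ)))
    obtain ⟨i, j, hij, he'⟩ := R.r_add σ τ
    let e := Equiv.ofBijective _ hij
    have he : ∀ A, R.r (σ + τ) A =
      R.r σ ((e ∘ Sum.inl) ⁻¹' A) + R.r τ ((e ∘ Sum.inr) ⁻¹' A) := he'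
    let E : Set (R.S (σ + τ)) ≃ Set (R.S σ) × Set (R.S τ) :=
      { toFun A := ((e ∘ Sum.inl) ⁻¹' A, (e ∘ Sum.inr) ⁻¹' A)
        invFun p := e.symm ⁻¹' (Sum.inl '' p.1 ∪ Sum.inr '' p.2)
        left_inv A := by
          ext x
          obtain ⟨x | x, rfl⟩ := e.surjective x <;> simp
        right_inv p := by
          refine Prod.ext ?_ ?_ <;> ext x <;> simp }
    have hE : ∀ A, R.r (σ + τ) A = R.r σ (E A).1 + R.r τ (E A).2 := he
    have hcover : ∀ A B, IsCover q A B ↔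
        IsCover q (E A).1 (E B).1 ∧ IsCover q (E A).2 (E B).2 := by
      intro A B
      simp only [IsCover, Set.eq_univ_iff_forall, Set.mem_union, Set.disjoint_left,
        e.surjective.forall, Sum.forall]
      change _ ↔ ((∀ x, e (Sum.inl x) ∈ A ∨ e (Sum.inl x) ∈ B) ∧
        (q → ∀ x, e (Sum.inl x) ∈ A → ¬ e (Sum.inl x) ∈ B)) ∧
        ((∀ x, e (Sum.inr x) ∈ A ∨ e (Sum.inr x) ∈ B) ∧
        (q → ∀ x, e (Sum.inr x) ∈ A → ¬ e (Sum.inr x) ∈ B))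
      tauto
    have hl : R.coprod q (σ + τ) =
        ∑ p : Set (R.S σ) × Set (R.S τ), ∑ p' : Set (R.S σ) × Set (R.S τ),
        if IsCover q p.1 p'.1 ∧ IsCover q p.2 p'.2 then
          gr (R.r σ p.1 + R.r τ p.2) ⊗ₜ[ℝ] gr (R.r σ p'.1 + R.r τ p'.2) else 0 := by
      refine Fintype.sum_equiv E _ _ fun A => Fintype.sum_equiv E _ _ fun B => ?_
      rw [hE, hE]
      exact if_congr (hcover A B) rfl rfl
    have hprod : ∀ a b c d : X,
        TensorProduct.map₂ disjProduct disjProduct (gr a ⊗ₜ[ℝ] gr b) (gr c ⊗ₜ[ℝ] gr d) =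
        gr (a + c) ⊗ₜ[ℝ] gr (b + d) := by
      simp [disjProduct]
    rw [hl]
    simp only [Fintype.sum_prod_type, coprod, coSum, map_sum, LinearMap.sum_apply]
    rw [Finset.sum_comm]
    refine Finset.sum_congr rfl fun A' _ => ?_
    symm
    rw [Finset.sum_comm]
    refine Finset.sum_congr rfl fun A _ => ?_
    rw [Finset.sum_comm]
    refine Finset.sum_congr rfl fun B _ => Finset.sum_congr rfl fun B' _ => ?_
    symm
    by_cases h1 : IsCover q A B
    · by_cases h2 : IsCover q A' B'
      · rw [if_pos ⟨h1, h2⟩, if_pos h1, if_pos h2, hprod]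
      · rw [if_neg fun h => h2 h.2, if_neg h2, map_zero]
    · rw [if_neg fun h => h1 h.1, if_neg h1, map_zero, LinearMap.zero_apply]
  eq_or_lt σ τ γ h := by
    classical
    let := Fintype.ofFinite (Set (R.S γ))
    rw [coprod, pairing_coSum] at h
    obtain ⟨A, -, h⟩ := Finset.exists_ne_zero_of_sum_ne_zero h
    obtain ⟨B, -, h⟩ := Finset.exists_ne_zero_of_sum_ne_zero h
    obtain ⟨hAB, rfl, rfl⟩ := (ite_ne_right_iff.1 h).1
    exact R.eq_or_lt γ A B hAB.1
  ne_zero σ τ := by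
    classical
    let := Fintype.ofFinite (Set (R.S (σ + τ)))
    obtain ⟨i, j, hij, he'⟩ := R.r_add σ τ
    let e := Equiv.ofBijective _ hij
    have he : ∀ A, R.r (σ + τ) A =
      R.r σ ((e ∘ Sum.inl) ⁻¹' A) + R.r τ ((e ∘ Sum.inr) ⁻¹' A) := he'
    rw [coprod, pairing_coSum]
    have hnn : ∀ p : Prop, [Decidable p] → (0 : ℝ) ≤ if p then 1 else 0 := fun p _ => by
      split_ifs <;> simp
    -- the cover by the ground sets of the two summands contributes
    apply ne_of_gt
    refine Finset.sum_pos' ?_ ⟨Set.range (e ∘ Sum.inl), Finset.mem_univ _, ?_⟩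
    · exact fun A _ => Finset.sum_nonneg fun B _ => hnn _
    refine Finset.sum_pos' (fun B _ => hnn _) ⟨Set.range (e ∘ Sum.inr), Finset.mem_univ _, ?_⟩
    rw [if_pos]
    · exact one_pos
    · refine ⟨⟨?_, fun _ => ?_⟩, ?_, ?_⟩
      · ext x
        obtain ⟨x | x, rfl⟩ := e.surjective x <;> simp
      · rw [Set.disjoint_left]
        rintro _ ⟨x, rfl⟩ ⟨y, hy⟩
        simp at hy
      · rw [he, Set.preimage_range]
        have : (e ∘ Sum.inr) ⁻¹' Set.range (e ∘ Sum.inl) = ∅ := by ext x; simp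
        rw [this, R.r_univ, R.r_empty, add_zero]
      · rw [he, Set.preimage_range]
        have : (e ∘ Sum.inl) ⁻¹' Set.range (e ∘ Sum.inr) = ∅ := by ext x; simp
        rw [this, R.r_univ, R.r_empty, zero_add]

end RestrictionSystem

/-! ### Unique decomposition of graphs into connected components -/

namespace FinGraph

theorem of_eq_zero {V : Type} [Finite V] [IsEmpty V] (G : SimpleGraph V) : of G = 0 :=
  of_eq ⟨Equiv.equivOfIsEmpty _ _, fun {a} => isEmptyElim a⟩

/-- A vertex set without edges to its complement splits off as a disjoint summand. -/
theorem of_eq_induce_add_induce_compl {V : Type} [Finite V] (G : SimpleGraph V) (U : Set V)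
    (hU : ∀ x y, G.Adj x y → (x ∈ U ↔ y ∈ U)) : of G = of (G.induce U) + of (G.induce Uᶜ) := by
  classical
  rw [of_add_of]
  refine (of_eq ⟨Equiv.Set.sumCompl U, ?_⟩).symm
  rintro (⟨x, hx⟩ | ⟨x, hx⟩) (⟨y, hy⟩ | ⟨y, hy⟩)
  · simp
  · simpa using fun h => hy ((hU _ _ h).1 hx)
  · simpa using fun h => hx ((hU _ _ h).2 hy)
  · simp

/-- A graph is the disjoint union of its connected components. By induction on the number of
vertices, it suffices to split off the component of a vertex. -/
theorem sum_components (τ : FinGraph) : τ.components.sum = τ := by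
  have key : ∀ n, ∀ τ : FinGraph, τ.card = n → τ.components.sum = τ := by
    intro n
    induction n using Nat.strong_induction_on with | _ n ih =>
    intro τ hτ
    induction τ using ind with | h m G =>
    by_cases hc : G.Connected
    · rw [components_connected ((connected_of G).2 hc), Multiset.sum_singleton]
    by_cases hm : Nonempty (Fin m)
    · have hp : ¬ G.Preconnected := fun h => hc ⟨h⟩
      simp only [SimpleGraph.Preconnected, not_forall] at hp
      obtain ⟨u, v, huv⟩ := hp
      let U : Set (Fin m) := {x | G.Reachable u x}
      have hU : of G = of (G.induce U) + of (G.induce Uᶜ) :=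
        of_eq_induce_add_induce_compl G U fun x y h =>
          ⟨fun hx => hx.trans h.reachable, fun hy => hy.trans h.symm.reachable⟩
      have h1 : (of (G.induce U)).card ≠ 0 := by
        have : Nonempty U := ⟨u, SimpleGraph.Reachable.refl u⟩
        rw [card_of]
        exact Nat.card_pos.ne'
      have h2 : (of (G.induce Uᶜ)).card ≠ 0 := by
        have : Nonempty ↥Uᶜ := ⟨v, huv⟩
        rw [card_of]
        exact Nat.card_pos.ne'
      rw [hU, card_add] at hτ
      rw [hU, components_add, Multiset.sum_add, ih _ (by omega) _ rfl, ih _ (by omega) _ rfl]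
    · rw [not_nonempty_iff] at hm
      rw [of_eq_zero, components_zero, Multiset.sum_zero]
  exact key _ τ rfl

/-- The decomposition of a graph into its connected components. -/
def decomposition : Decomposition FinGraph where
  Conn := Connected
  comp := components
  comp_add := components_add
  comp_sum := sum_components
  comp_conn _ := components_connected
  conn_of_mem _ _ := connected_of_mem_components

theorem rank_of {V : Type} [Finite V] (G : SimpleGraph V) :
    decomposition.rank (of G) = Nat.card G.ConnectedComponent := by
  let := Fintype.ofFinite G.ConnectedComponent
  change (of G).components.card = _
  rw [components_of, componentsOf, Multiset.card_map,
    Nat.card_eq_fintype_card]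
  rfl

theorem isLeft_eq_of_reachable {V W : Type} {G : SimpleGraph V} {H : SimpleGraph W} {x y : V ⊕ W}
    (h : (G ⊕g H).Reachable x y) : x.isLeft = y.isLeft := by
  obtain ⟨p⟩ := h
  induction p with
  | nil => rfl
  | @cons x y z hxy p ih =>
    rw [← ih]
    rcases x with x | x <;> rcases y with y | y <;> simp at hxy ⊢

/-- If two graphs, each mapped injectively into `G`, cover all vertices of `G` and all edges inside
one of their images, then either `G` is their disjoint union, or it has fewer connected components
than their disjoint union. Indeed the map on connected components is surjective; if it is also
injective, then the images of the two graphs are disjoint and there are no edges between them. -/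
theorem of_eq_add_or_rank_lt {V V₁ V₂ : Type} [Finite V] [Finite V₁] [Finite V₂]
    {G : SimpleGraph V} {H₁ : SimpleGraph V₁} {H₂ : SimpleGraph V₂} (φ : H₁ ⊕g H₂ →g G)
    (hφ : Function.Surjective φ) (hl : Function.Injective (φ ∘ Sum.inl))
    (hr : Function.Injective (φ ∘ Sum.inr))
    (hedge : ∀ u v, G.Adj u v → (∃ x y, (H₁ ⊕g H₂).Adj x y ∧ φ x = u ∧ φ y = v) ∨
      (∃ a b, φ (Sum.inl a) = u ∧ φ (Sum.inr b) = v) ∨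
      ∃ a b, φ (Sum.inl a) = v ∧ φ (Sum.inr b) = u) :
    of G = of H₁ + of H₂ ∨
      decomposition.rank (of G) < decomposition.rank (of H₁) + decomposition.rank (of H₂) := by
  rw [← Decomposition.rank_add, of_add_of, rank_of, rank_of, or_iff_not_imp_right, not_lt]
  intro hcard
  have hsurj : Function.Surjective (SimpleGraph.ConnectedComponent.map φ) := by
    intro c
    induction c using SimpleGraph.ConnectedComponent.ind with | h v =>
    obtain ⟨x, rfl⟩ := hφ v
    exact ⟨(H₁ ⊕g H₂).connectedComponentMk x, rfl⟩
  have hinj := (hsurj.bijective_of_nat_card_le hcard).1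
  -- vertices of the two summands are never joined in `G`
  have hleft : ∀ x y, G.Reachable (φ x) (φ y) → x.isLeft = y.isLeft := fun x y h =>
    isLeft_eq_of_reachable (SimpleGraph.ConnectedComponent.exact
      (hinj (SimpleGraph.ConnectedComponent.sound h)))
  have hφi : Function.Injective φ := by
    intro x y h
    have h' := hleft x y (h ▸ SimpleGraph.Reachable.refl _)
    rcases x with x | x <;> rcases y with y | y <;> simp at h'
    · exact congrArg _ (hl h)
    · exact congrArg _ (hr h)
  refine of_eq (SimpleGraph.Iso.symm ⟨Equiv.ofBijective φ ⟨hφi, hφ⟩, fun {x y} => ?_⟩)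
  refine ⟨fun h => ?_, fun h => φ.map_adj h⟩
  have h' := hleft x y (SimpleGraph.Adj.reachable h)
  rcases hedge _ _ h with ⟨x', y', hxy, hx, hy⟩ | ⟨a, b, ha, hb⟩ | ⟨a, b, ha, hb⟩
  · rwa [← hφi hx, ← hφi hy]
  · rw [← hφi ha, ← hφi hb] at h'
    simp at h'
  · rw [← hφi ha, ← hφi hb] at h'
    simp at h'

/-! ### Restriction of graphs to vertex sets -/

/-- A representative of an isomorphism class of graphs. -/
def rep (τ : FinGraph) : Σ n : ℕ, SimpleGraph (Fin n) := Quotient.out (s := finGraphSetoid) τ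

theorem of_rep (τ : FinGraph) : of τ.rep.2 = τ :=
  (of_fin _).trans (Quotient.out_eq (s := finGraphSetoid) τ)

theorem isEmpty_rep_zero : IsEmpty (Fin (rep 0).1) := by
  have h := congrArg card (of_rep 0)
  rw [card_of, card_zero, Nat.card_fin] at h
  rw [h]
  infer_instance

theorem of_induce_image {V W : Type} [Finite V] [Finite W] {G : SimpleGraph V} {H : SimpleGraph W}
    (j : H ↪g G) (B : Set W) : of (H.induce B) = of (G.induce (j '' B)) :=
  of_eq ⟨Equiv.Set.image j B j.injective, fun {_ _} => j.map_rel_iff⟩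

theorem of_induce_sum {V W : Type} [Finite V] [Finite W] (G : SimpleGraph V) (H : SimpleGraph W)
    (A : Set (V ⊕ W)) : of ((G ⊕g H).induce A) =
      of (G.induce (Sum.inl ⁻¹' A)) + of (H.induce (Sum.inr ⁻¹' A)) := by
  rw [of_add_of]
  refine of_eq ⟨Equiv.subtypeSum, ?_⟩
  rintro ⟨x | x, hx⟩ ⟨y | y, hy⟩ <;> rfl

theorem induce_eq_or_lt {V : Type} [Finite V] (G : SimpleGraph V) {A B : Set V}
    (h : A ∪ B = Set.univ) : of G = of (G.induce A) + of (G.induce B) ∨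
      decomposition.rank (of G) <
        decomposition.rank (of (G.induce A)) + decomposition.rank (of (G.induce B)) := by
  let φ : G.induce A ⊕g G.induce B →g G := ⟨Sum.elim Subtype.val Subtype.val, by
    rintro (x | x) (y | y) h
    · simpa using h
    · simp at h
    · simp at h
    · simpa using h⟩
  refine of_eq_add_or_rank_lt φ (fun v => ?_) Subtype.val_injective Subtype.val_injective
    fun u v huv => ?_
  · rcases (h ▸ Set.mem_univ v : v ∈ A ∪ B) with hv | hv
    · exact ⟨Sum.inl ⟨v, hv⟩, rfl⟩
    · exact ⟨Sum.inr ⟨v, hv⟩, rfl⟩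
  · rcases (h ▸ Set.mem_univ u : u ∈ A ∪ B) with hu | hu <;>
      rcases (h ▸ Set.mem_univ v : v ∈ A ∪ B) with hv | hv
    · exact Or.inl ⟨Sum.inl ⟨u, hu⟩, Sum.inl ⟨v, hv⟩, by simpa using huv, rfl, rfl⟩
    · exact Or.inr (Or.inl ⟨⟨u, hu⟩, ⟨v, hv⟩, rfl, rfl⟩)
    · exact Or.inr (Or.inr ⟨⟨v, hv⟩, ⟨u, hu⟩, rfl, rfl⟩)
    · exact Or.inl ⟨Sum.inr ⟨u, hu⟩, Sum.inr ⟨v, hv⟩, by simpa using huv, rfl, rfl⟩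

/-- Induced subgraphs on sets of vertices. The ground set consists of the vertices of a chosen
representative. -/
def vertexRestriction : RestrictionSystem FinGraph decomposition where
  S τ := Fin τ.rep.1
  r τ A := of (τ.rep.2.induce A)
  isEmpty_zero := isEmpty_rep_zero
  r_univ τ := (of_eq (SimpleGraph.induceUnivIso _)).trans (of_rep τ)
  r_empty τ := of_eq_zero _
  r_r τ A := by
    obtain ⟨f⟩ := of_eq_of_iff.1 (of_rep (of (τ.rep.2.induce A)))
    let j := (SimpleGraph.Embedding.induce A).comp f.toEmbedding
    refine ⟨j, j.injective, ?_, of_induce_image j⟩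
    change Set.range (Subtype.val ∘ f) = A
    rw [f.surjective.range_comp, Subtype.range_coe]
  r_add σ τ := by
    have h : of (σ.rep.2 ⊕g τ.rep.2) = of (σ + τ).rep.2 := by
      rw [← of_add_of, of_rep, of_rep, of_rep]
    obtain ⟨f⟩ := of_eq_of_iff.1 h
    refine ⟨f ∘ Sum.inl, f ∘ Sum.inr, ?_, fun A => ?_⟩
    · rw [← Sum.comp_elim, Sum.elim_inl_inr, Function.comp_id]
      exact f.bijective
    · rw [Set.preimage_comp, Set.preimage_comp, ← of_induce_sum, of_induce_image f.toEmbedding]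
      exact congrArg (fun B : Set (Fin (σ + τ).rep.1) => of ((σ + τ).rep.2.induce B))
        (Set.image_preimage_eq A f.surjective).symm
  eq_or_lt τ A B h := by
    have := induce_eq_or_lt τ.rep.2 h
    rwa [of_rep] at this

theorem coInducedShuffle_eq : coInducedShuffle = vertexRestriction.coprod True := by
  funext τ
  conv_lhs => rw [← of_rep τ, coInducedShuffle_of, coShuffleSum_eq_coSum]
  rfl

theorem coInducedQuasiShuffle_eq : coInducedQuasiShuffle = vertexRestriction.coprod False := by
  funext τ
  conv_lhs => rw [← of_rep τ, coInducedQuasiShuffle_of, coQuasiShuffleSum_eq_coSum]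
  rfl

theorem isGoodProduct_dpProduct : IsGoodProduct decomposition dpProduct :=
  (isGoodCoproduct_coDPProd decomposition).isGoodProduct dualizable_coDP

theorem isGoodProduct_inducedShuffle : IsGoodProduct decomposition inducedShuffle :=
  IsGoodCoproduct.isGoodProduct (coInducedShuffle_eq ▸ vertexRestriction.isGoodCoproduct True)
    dualizable_coInducedShuffle

theorem isGoodProduct_inducedQuasiShuffle : IsGoodProduct decomposition inducedQuasiShuffle :=
  IsGoodCoproduct.isGoodProduct (coInducedQuasiShuffle_eq ▸ vertexRestriction.isGoodCoproduct False)
    dualizable_coInducedQuasiShuffle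

end FinGraph

/-! ### Restriction of graphs to edge sets -/

namespace FinGraph

/-- Restriction to a set of edges depends only on the image of these edges under an injective
homomorphism, which need not reflect adjacency. -/
theorem ofRestrict_image {V W : Type} [Finite V] [Finite W] {G : SimpleGraph V}
    {H : SimpleGraph W} (j : H →g G) (hj : Function.Injective j) (B : Set H.edgeSet) :
    ofRestrict H B = ofRestrict G (j.mapEdgeSet '' B) := by
  have hmem : ∀ v, (∃ e ∈ B, v ∈ (e : Sym2 W)) →
      ∃ e ∈ j.mapEdgeSet '' B, j v ∈ (e : Sym2 V) := fun v ⟨e, he, hv⟩ =>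
    ⟨_, ⟨e, he, rfl⟩, Sym2.mem_map.2 ⟨v, hv, rfl⟩⟩
  refine Subtype.ext (of_eq ⟨Equiv.ofBijective (fun v => ⟨j v.1, hmem v.1 v.2⟩) ⟨?_, ?_⟩, ?_⟩)
  · intro v w h
    exact Subtype.ext (hj (congrArg Subtype.val h))
  · rintro ⟨v, _, ⟨e, he, rfl⟩, hv⟩
    obtain ⟨w, hw, rfl⟩ := Sym2.mem_map.1 hv
    exact ⟨⟨w, e, he, hw⟩, rfl⟩
  · intro a b
    rw [edgeRestrict_adj, edgeRestrict_adj, Set.exists_mem_image]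
    refine exists_congr fun x => and_congr_right fun _ => ?_
    change Sym2.map j x.1 = Sym2.map j s(a.1, b.1) ↔ _
    exact (Sym2.map.injective hj).eq_iff

/-- Restricting a disjoint union to a set of edges restricts both summands. -/
theorem ofRestrict_sum {V W : Type} [Finite V] [Finite W] (G : SimpleGraph V) (H : SimpleGraph W)
    (A : Set (G ⊕g H).edgeSet) : ofRestrict (G ⊕g H) A =
      ofRestrict G ((SimpleGraph.Embedding.sumInl (G := G) (H := H)).toHom.mapEdgeSet ⁻¹' A) +
      ofRestrict H ((SimpleGraph.Embedding.sumInr (G := G) (H := H)).toHom.mapEdgeSet ⁻¹' A) := by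
  set il := (SimpleGraph.Embedding.sumInl (G := G) (H := H)).toHom
  set ir := (SimpleGraph.Embedding.sumInr (G := G) (H := H)).toHom
  have hl : ∀ v, (∃ e ∈ il.mapEdgeSet ⁻¹' A, v ∈ (e : Sym2 V)) →
      ∃ e ∈ A, Sum.inl v ∈ (e : Sym2 (V ⊕ W)) := fun v ⟨e, he, hv⟩ =>
    ⟨_, he, Sym2.mem_map.2 ⟨v, hv, rfl⟩⟩
  have hr : ∀ v, (∃ e ∈ ir.mapEdgeSet ⁻¹' A, v ∈ (e : Sym2 W)) →
      ∃ e ∈ A, Sum.inr v ∈ (e : Sym2 (V ⊕ W)) := fun v ⟨e, he, hv⟩ =>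
    ⟨_, he, Sym2.mem_map.2 ⟨v, hv, rfl⟩⟩
  refine Subtype.ext ?_
  change of _ = of _ + of _
  rw [of_add_of]
  symm
  refine of_eq ⟨Equiv.ofBijective (Sum.elim (fun v => ⟨Sum.inl v.1, hl v.1 v.2⟩)
    (fun v => ⟨Sum.inr v.1, hr v.1 v.2⟩)) ⟨?_, ?_⟩, ?_⟩
  · rintro (v | v) (w | w) h <;> have h := congrArg Subtype.val h
    · exact congrArg Sum.inl (Subtype.ext (Sum.inl_injective h))
    · cases h
    · cases h
    · exact congrArg Sum.inr (Subtype.ext (Sum.inr_injective h))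
  · rintro ⟨v, ⟨e, hadj⟩, he, hv⟩
    obtain ⟨w, rfl⟩ := Sym2.mem_iff_exists.1 hv
    rw [SimpleGraph.mem_edgeSet] at hadj
    rcases v with v | v <;> rcases w with w | w
    · exact ⟨Sum.inl ⟨v, ⟨s(v, w), by simpa using hadj⟩, he, Sym2.mem_mk_left v w⟩, rfl⟩
    · simp at hadj
    · simp at hadj
    · exact ⟨Sum.inr ⟨v, ⟨s(v, w), by simpa using hadj⟩, he, Sym2.mem_mk_left v w⟩, rfl⟩
  · have hi : ∀ (e : (G ⊕g H).edgeSet) x y, (e : Sym2 (V ⊕ W)) = s(x, y) → (G ⊕g H).Adj x y :=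
      fun e x y h => by
        have := e.2
        rwa [h] at this
    rintro (a | a) (b | b)
    · change (edgeRestrict (G ⊕g H) A).Adj _ _ ↔ (edgeRestrict G _).Adj a b
      rw [edgeRestrict_adj, edgeRestrict_adj]
      constructor
      · rintro ⟨e, he, h⟩
        have hadj : G.Adj a.1 b.1 := by simpa using hi e (Sum.inl a.1) (Sum.inl b.1) h
        refine ⟨⟨s(a.1, b.1), hadj⟩, ?_, rfl⟩
        have : il.mapEdgeSet ⟨s(a.1, b.1), hadj⟩ = e := Subtype.ext h.symm
        rwa [Set.mem_preimage, this]
      · rintro ⟨e, he, h⟩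
        exact ⟨_, he, congrArg (Sym2.map il) h⟩
    · refine iff_of_false (fun h => ?_) (by simp)
      obtain ⟨e, -, h⟩ := edgeRestrict_adj.1 h
      simpa using hi e (Sum.inl a.1) (Sum.inr b.1) h
    · refine iff_of_false (fun h => ?_) (by simp)
      obtain ⟨e, -, h⟩ := edgeRestrict_adj.1 h
      simpa using hi e (Sum.inr a.1) (Sum.inl b.1) h
    · change (edgeRestrict (G ⊕g H) A).Adj _ _ ↔ (edgeRestrict H _).Adj a b
      rw [edgeRestrict_adj, edgeRestrict_adj]
      constructor
      · rintro ⟨e, he, h⟩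
        have hadj : H.Adj a.1 b.1 := by simpa using hi e (Sum.inr a.1) (Sum.inr b.1) h
        refine ⟨⟨s(a.1, b.1), hadj⟩, ?_, rfl⟩
        have : ir.mapEdgeSet ⟨s(a.1, b.1), hadj⟩ = e := Subtype.ext h.symm
        rwa [Set.mem_preimage, this]
      · rintro ⟨e, he, h⟩
        exact ⟨_, he, congrArg (Sym2.map ir) h⟩

/-- The edges of a disjoint union are the edges of the summands. -/
theorem bijective_mapEdgeSet_sum {V W : Type} (G : SimpleGraph V) (H : SimpleGraph W) :
    Function.Bijective (Sum.elim
      (SimpleGraph.Embedding.sumInl (G := G) (H := H)).toHom.mapEdgeSet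
      (SimpleGraph.Embedding.sumInr (G := G) (H := H)).toHom.mapEdgeSet) := by
  constructor
  · refine Function.Injective.sumElim (SimpleGraph.Hom.mapEdgeSet.injective _ Sum.inl_injective)
      (SimpleGraph.Hom.mapEdgeSet.injective _ Sum.inr_injective) ?_
    rintro ⟨a, ha⟩ ⟨b, hb⟩ h
    have h : Sym2.map Sum.inl a = Sym2.map Sum.inr b := congrArg Subtype.val h
    induction a using Sym2.ind with | _ x y =>
    have : Sum.inl x ∈ Sym2.map Sum.inr b := h ▸ Sym2.mem_map.2 ⟨x, Sym2.mem_mk_left x y, rfl⟩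
    obtain ⟨z, -, hz⟩ := Sym2.mem_map.1 this
    cases hz
  · rintro ⟨e, he⟩
    induction e using Sym2.ind with | _ x y =>
    rw [SimpleGraph.mem_edgeSet] at he
    rcases x with x | x <;> rcases y with y | y
    · exact ⟨Sum.inl ⟨s(x, y), by simpa using he⟩, rfl⟩
    · simp at he
    · simp at he
    · exact ⟨Sum.inr ⟨s(x, y), by simpa using he⟩, rfl⟩

/-- A graph without isolated vertices is spanned by its edges. -/
theorem ofRestrict_univ {V : Type} [Finite V] {G : SimpleGraph V} (hG : ∀ v, ∃ w, G.Adj v w) :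
    of (edgeRestrict G Set.univ) = of G := by
  have h : ∀ v, ∃ e ∈ (Set.univ : Set G.edgeSet), v ∈ (e : Sym2 V) := fun v => by
    obtain ⟨w, hw⟩ := hG v
    exact ⟨⟨s(v, w), hw⟩, Set.mem_univ _, Sym2.mem_mk_left v w⟩
  refine of_eq ⟨Equiv.subtypeUnivEquiv h, fun {a b} => ?_⟩
  rw [edgeRestrict_adj]
  constructor
  · exact fun hab => ⟨⟨s(a.1, b.1), hab⟩, Set.mem_univ _, rfl⟩
  · rintro ⟨e, -, he⟩
    have := e.2
    rwa [he] at this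

theorem restrict_eq_or_lt {V : Type} [Finite V] {G : SimpleGraph V} (hG : ∀ v, ∃ w, G.Adj v w)
    {A B : Set G.edgeSet} (h : A ∪ B = Set.univ) :
    of G = of (edgeRestrict G A) + of (edgeRestrict G B) ∨
      decomposition.rank (of G) < decomposition.rank (of (edgeRestrict G A)) +
        decomposition.rank (of (edgeRestrict G B)) := by
  have hadj : ∀ (C : Set G.edgeSet) x y, (edgeRestrict G C).Adj x y → G.Adj x.1 y.1 :=
    fun C x y hxy => by
      obtain ⟨e, -, he⟩ := edgeRestrict_adj.1 hxy
      have := e.2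
      rwa [he] at this
  let φ : edgeRestrict G A ⊕g edgeRestrict G B →g G := ⟨Sum.elim Subtype.val Subtype.val, by
    rintro (x | x) (y | y) h
    · exact hadj A x y (by simpa using h)
    · simp at h
    · simp at h
    · exact hadj B x y (by simpa using h)⟩
  have hedge : ∀ u v, G.Adj u v →
      ∃ x y, (edgeRestrict G A ⊕g edgeRestrict G B).Adj x y ∧ φ x = u ∧ φ y = v := by
    intro u v huv
    rcases (h ▸ Set.mem_univ (⟨s(u, v), huv⟩ : G.edgeSet) : _ ∈ A ∪ B) with h | h
    · refine ⟨Sum.inl ⟨u, _, h, Sym2.mem_mk_left u v⟩, Sum.inl ⟨v, _, h, Sym2.mem_mk_right u v⟩,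
        ?_, rfl, rfl⟩
      change (edgeRestrict G A).Adj _ _
      rw [edgeRestrict_adj]
      exact ⟨_, h, rfl⟩
    · refine ⟨Sum.inr ⟨u, _, h, Sym2.mem_mk_left u v⟩, Sum.inr ⟨v, _, h, Sym2.mem_mk_right u v⟩,
        ?_, rfl, rfl⟩
      change (edgeRestrict G B).Adj _ _
      rw [edgeRestrict_adj]
      exact ⟨_, h, rfl⟩
  refine of_eq_add_or_rank_lt φ (fun v => ?_) Subtype.val_injective Subtype.val_injective
    fun u v huv => Or.inl (hedge u v huv)
  obtain ⟨w, hw⟩ := hG v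
  obtain ⟨x, -, -, hx, -⟩ := hedge v w hw
  exact ⟨x, hx⟩

end FinGraph

namespace FinGraphNo

open FinGraph

theorem components_add (σ τ : FinGraphNo) : (σ + τ).components = σ.components + τ.components :=
  Multiset.map_injective Subtype.val_injective <| by
    rw [map_components, AddSubmonoid.coe_add, FinGraph.components_add, Multiset.map_add,
      map_components, map_components]

/-- The decomposition of a graph without isolated vertices into its connected components. -/
def decomposition : Decomposition FinGraphNo where
  Conn τ := (τ : FinGraph).Connected
  comp := components
  comp_add := components_add
  comp_sum τ := Subtype.ext <| by
    rw [AddSubmonoid.coe_multiset_sum, map_components, sum_components]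
  comp_conn τ h := Multiset.map_injective Subtype.val_injective <| by
    rw [map_components, components_connected h, Multiset.map_singleton]
  conn_of_mem τ c hc := connected_of_mem_components (τ := τ) <| by
    rw [← map_components]
    exact Multiset.mem_map_of_mem _ hc

theorem rank_eq (τ : FinGraphNo) : decomposition.rank τ = FinGraph.decomposition.rank τ := by
  change τ.components.card = (τ : FinGraph).components.card
  rw [← map_components, Multiset.card_map]

theorem exists_adj_rep (τ : FinGraphNo) : ∀ v, ∃ w, (τ : FinGraph).rep.2.Adj v w := by
  rw [← noIsolated_of, of_rep]
  exact τ.2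

/-- Subgraphs spanned by sets of edges: the vertices are the endpoints of the edges in the set. The
ground set consists of the edges of a chosen representative. -/
def edgeRestriction : RestrictionSystem FinGraphNo decomposition where
  S τ := (τ : FinGraph).rep.2.edgeSet
  r τ A := ofRestrict (τ : FinGraph).rep.2 A
  isEmpty_zero := ⟨fun ⟨e, _⟩ => by
    have := isEmpty_rep_zero
    induction e using Sym2.ind with | _ x y => exact isEmptyElim x⟩
  r_univ τ := Subtype.ext ((ofRestrict_univ τ.exists_adj_rep).trans (of_rep _))
  r_empty τ := by
    have : IsEmpty {v | ∃ e ∈ (∅ : Set (τ : FinGraph).rep.2.edgeSet),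
        v ∈ (e : Sym2 (Fin (τ : FinGraph).rep.1))} :=
      ⟨fun ⟨_, _, he, _⟩ => he⟩
    exact Subtype.ext (of_eq_zero _)
  r_r τ A := by
    obtain ⟨f⟩ := of_eq_of_iff.1 (of_rep (ofRestrict (τ : FinGraph).rep.2 A))
    let i : edgeRestrict (τ : FinGraph).rep.2 A →g (τ : FinGraph).rep.2 :=
      ⟨Subtype.val, fun {x y} hxy => by
        obtain ⟨e, -, he⟩ := edgeRestrict_adj.1 hxy
        have := e.2
        rwa [he] at this⟩
    let j := i.comp f.toHom
    have hj : Function.Injective j := Subtype.val_injective.comp f.injective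
    refine ⟨j.mapEdgeSet, SimpleGraph.Hom.mapEdgeSet.injective _ hj, ?_, ofRestrict_image j hj⟩
    ext ⟨e, he⟩
    induction e using Sym2.ind with | _ x y =>
    constructor
    · rintro ⟨⟨e, he'⟩, h⟩
      induction e using Sym2.ind with | _ u v =>
      obtain ⟨d, hd, hd'⟩ := edgeRestrict_adj.1 (f.map_adj_iff.2 he')
      have : d = ⟨s(x, y), he⟩ := Subtype.ext (hd'.trans (congrArg Subtype.val h))
      exact this ▸ hd
    · intro h
      have hadj : (edgeRestrict (τ : FinGraph).rep.2 A).Adj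
          ⟨x, _, h, Sym2.mem_mk_left x y⟩ ⟨y, _, h, Sym2.mem_mk_right x y⟩ :=
        edgeRestrict_adj.2 ⟨_, h, rfl⟩
      refine ⟨⟨s(f.symm ⟨x, _, h, Sym2.mem_mk_left x y⟩, f.symm ⟨y, _, h, Sym2.mem_mk_right x y⟩),
        f.symm.map_adj_iff.2 hadj⟩, Subtype.ext ?_⟩
      change s(i (f (f.symm _)), i (f (f.symm _))) = s(x, y)
      rw [f.apply_symm_apply, f.apply_symm_apply]
      rfl
  r_add σ τ := by
    have h : of ((σ : FinGraph).rep.2 ⊕g (τ : FinGraph).rep.2) =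
        of ((σ + τ : FinGraphNo) : FinGraph).rep.2 := by
      rw [← of_add_of, of_rep, of_rep, of_rep, AddSubmonoid.coe_add]
    obtain ⟨f⟩ := of_eq_of_iff.1 h
    refine ⟨f.mapEdgeSet ∘ (SimpleGraph.Embedding.sumInl (G := (σ : FinGraph).rep.2)
        (H := (τ : FinGraph).rep.2)).toHom.mapEdgeSet,
      f.mapEdgeSet ∘ (SimpleGraph.Embedding.sumInr (G := (σ : FinGraph).rep.2)
        (H := (τ : FinGraph).rep.2)).toHom.mapEdgeSet, ?_, fun A => ?_⟩
    · rw [← Sum.comp_elim]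
      exact f.mapEdgeSet.bijective.comp (bijective_mapEdgeSet_sum _ _)
    · rw [Set.preimage_comp, Set.preimage_comp, ← ofRestrict_sum, ofRestrict_congr f,
        Set.image_preimage_eq _ f.mapEdgeSet.surjective]
  eq_or_lt τ A B h := by
    have := restrict_eq_or_lt τ.exists_adj_rep h
    rw [of_rep] at this
    rw [rank_eq, rank_eq, rank_eq]
    exact this.imp_left fun h => Subtype.ext h

theorem coShuffle_eq : coShuffle = edgeRestriction.coprod True := by
  funext τ
  rw [coShuffle, ← of_rep τ, coEdgeShuffle_of, coShuffleSum_eq_coSum]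
  rfl

theorem coQuasiShuffle_eq : coQuasiShuffle = edgeRestriction.coprod False := by
  funext τ
  rw [coQuasiShuffle, ← of_rep τ, coEdgeQuasiShuffle_of, coQuasiShuffleSum_eq_coSum]
  rfl

theorem isGoodProduct_dpProduct : IsGoodProduct decomposition dpProduct :=
  (isGoodCoproduct_coDPProd decomposition).isGoodProduct dualizable_coDP

theorem isGoodProduct_shuffle : IsGoodProduct decomposition shuffle :=
  IsGoodCoproduct.isGoodProduct (coShuffle_eq ▸ edgeRestriction.isGoodCoproduct True)
    dualizable_coShuffle

theorem isGoodProduct_quasiShuffle : IsGoodProduct decomposition quasiShuffle :=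
  IsGoodCoproduct.isGoodProduct (coQuasiShuffle_eq ▸ edgeRestriction.isGoodCoproduct False)
    dualizable_coQuasiShuffle

/-- Summands of a graph without isolated vertices have no isolated vertices. -/
theorem noIsolated_of_add {a b : FinGraph} (h : a + b ∈ noIsolated) : a ∈ noIsolated := by
  induction a using ind with | h _ G => induction b using ind with | h _ H =>
  rw [of_add_of] at h
  have h : ∀ v, ∃ w, (G ⊕g H).Adj v w := (noIsolated_of _).1 h
  refine (noIsolated_of G).2 fun v => ?_
  obtain ⟨w | w, hw⟩ := h (Sum.inl v)
  · exact ⟨w, by simpa using hw⟩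
  · simp at hw

theorem exists_of_add_eq (a b : FinGraph) (c : FinGraphNo) (h : a + b = noIsolated.subtype c) :
    ∃ a' b', noIsolated.subtype a' = a ∧ noIsolated.subtype b' = b := by
  have hc : a + b ∈ noIsolated := h ▸ c.2
  exact ⟨⟨a, noIsolated_of_add hc⟩, ⟨b, noIsolated_of_add (add_comm a b ▸ hc)⟩, rfl, rfl⟩

theorem isGoodProduct_inducedShuffle : IsGoodProduct decomposition inducedShuffle :=
  FinGraph.isGoodProduct_inducedShuffle.restrict noIsolated.subtype Subtype.val_injective
    exists_of_add_eq rank_eq incl_inducedShuffle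

theorem isGoodProduct_inducedQuasiShuffle : IsGoodProduct decomposition inducedQuasiShuffle :=
  FinGraph.isGoodProduct_inducedQuasiShuffle.restrict noIsolated.subtype Subtype.val_injective
    exists_of_add_eq rank_eq incl_inducedQuasiShuffle

end FinGraphNo

end

theorem mainTheorem1 :
    (∀ m ∈ ({FinGraph.dpProduct, FinGraph.inducedShuffle, FinGraph.inducedQuasiShuffle} :
        Set (BilinProduct FinGraph)),
      ∃ (_ : (symHopf FinGraph.coDP).IsHopf) (_ : (dualHopf m).IsHopf)
        (Ψ : (symHopf FinGraph.coDP).Carrier ≃ₐc[ℝ] (dualHopf m).Carrier),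
        (∀ s : Multiset FinGraph, (∀ τ ∈ s, τ.Connected) →
          Ψ ((symHopf FinGraph.coDP).toCarrier (gr s.sum)) =
            (s.map fun τ => (dualHopf m).toCarrier (gr τ)).prod) ∧
        (∀ x, Ψ (HopfAlgebra.antipode ℝ x) = HopfAlgebra.antipode ℝ (Ψ x)) ∧
        Function.Bijective (MvPolynomial.aeval (R := ℝ)
          fun τ : {τ : FinGraph // τ.Connected} => (dualHopf m).toCarrier (gr τ.1))) ∧
    (∀ m ∈ ({FinGraphNo.dpProduct, FinGraphNo.shuffle, FinGraphNo.quasiShuffle,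
        FinGraphNo.inducedShuffle, FinGraphNo.inducedQuasiShuffle} :
        Set (BilinProduct FinGraphNo)),
      ∃ (_ : (symHopf FinGraphNo.coDP).IsHopf) (_ : (dualHopf m).IsHopf)
        (Ψ : (symHopf FinGraphNo.coDP).Carrier ≃ₐc[ℝ] (dualHopf m).Carrier),
        (∀ s : Multiset FinGraphNo, (∀ τ ∈ s, (τ : FinGraph).Connected) →
          Ψ ((symHopf FinGraphNo.coDP).toCarrier (gr s.sum)) =
            (s.map fun τ => (dualHopf m).toCarrier (gr τ)).prod) ∧
        (∀ x, Ψ (HopfAlgebra.antipode ℝ x) = HopfAlgebra.antipode ℝ (Ψ x)) ∧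
        Function.Bijective (MvPolynomial.aeval (R := ℝ)
          fun τ : {τ : FinGraphNo // (τ : FinGraph).Connected} => (dualHopf m).toCarrier (gr τ.1))) := by
  constructor
  · rintro m (rfl | rfl | rfl)
    · exact FinGraph.isGoodProduct_dpProduct.exists_bialgEquiv
    · exact FinGraph.isGoodProduct_inducedShuffle.exists_bialgEquiv
    · exact FinGraph.isGoodProduct_inducedQuasiShuffle.exists_bialgEquiv
  · rintro m (rfl | rfl | rfl | rfl | rfl)
    · exact FinGraphNo.isGoodProduct_dpProduct.exists_bialgEquiv
    · exact FinGraphNo.isGoodProduct_shuffle.exists_bialgEquiv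
    · exact FinGraphNo.isGoodProduct_quasiShuffle.exists_bialgEquiv
    · exact FinGraphNo.isGoodProduct_inducedShuffle.exists_bialgEquiv
    · exact FinGraphNo.isGoodProduct_inducedQuasiShuffle.exists_bialgEquiv
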